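/- Let $n\ge 3$ and $N=\binom{n-2}{2}$. Let $\bar F_n\subset(\mathbb CP^1)^N$ be the set of points $\big((c_{ij}:c'_{ij})\big)_{3\le i<j\le n}$ that satisfy $$c_{ij}\,c'_{ik}\,c_{jk}=c'_{ij}\,c_{ik}\,c'_{jk}\qquad\text{for all } 3\le i<j<k\le n .$$ Let $\mathbf t=(t_1,\dots,t_{n-3})\in(\mathbb C^*)^{n-3}$ act on $(\mathbb CP^1)^N$ by $(c_{ij}:c'_{ij})\mapsto(\rho_{ij}(\mathbf t)\,c_{ij}:c'_{ij})$, where $\rho_{3k}(\mathbf t)=t_{k-3}$ for $4\le k\le n$ and $\rho_{ij}(\mathbf t)=t_{j-3}/t_{i-3}$ for $4\le i<j\le n$. Then $\bar F_n$ is invariant under this action and is a smooth toric variety for it: it is irreducible, smooth of dimension $n-3$, and contains a Zariski open orbit of a point with trivial stabilizer. Moreover, $\bar F_n$ is the permutohedral toric variety: there are an isomorphism of algebraic tori from $(\mathbb C^*)^{n-3}$ to the torus of $X$ and an isomorphism of algebraic varieties $\bar F_n\to X$ equivariant with respect to it, where $X$ is the toric variety of the normal fan of the $(n-3)$-dimensional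 permutohedron, that is, of the convex hull in $\mathbb R^{n-2}$ of the points whose coordinates are $1,\dots,n-2$ in some order, with character lattice $\{m\in\mathbb Z^{n-2}:\sum_i m_i=0\}$. -/

import Mathlib

namespace PermutohedralToric

/-! ### Complex algebraic varieties presented by affine charts -/

/-- A presentation of a classical complex (pre)variety with underlying point set `X` by affine
charts: chart `a` has the point set `pts a`, is placed in `X` by `incl a`, and has the
coordinate ring `coord a`, a `ℂ`-algebra of complex valued functions on `pts a`. -/
structure ChartData (X : Type) where
  Chart : Type
  pts : Chart → Type
  incl : (a : Chart) → pts a → X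
  coord : (a : Chart) → Subalgebra ℂ (pts a → ℂ)

namespace ChartData

variable {X Y : Type}

/-- The Zariski topology: `W` is open iff its trace on every chart is a union of principal open
sets `{g ≠ 0}`, with `g` in the coordinate ring of the chart. -/
@[reducible] def topology (𝒜 : ChartData X) : TopologicalSpace X where
  IsOpen W := ∀ (a : 𝒜.Chart) (x : 𝒜.pts a), 𝒜.incl a x ∈ W →
    ∃ g ∈ 𝒜.coord a, g x ≠ 0 ∧ ∀ y : 𝒜.pts a, g y ≠ 0 → 𝒜.incl a y ∈ W
  isOpen_univ := fun a _ _ => ⟨1, one_mem _, by simp, fun _ _ => trivial⟩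
  isOpen_inter := by
    intro S T hS hT a x hx
    obtain ⟨g, hg, hgx, hgS⟩ := hS a x hx.1
    obtain ⟨h, hh, hhx, hhT⟩ := hT a x hx.2
    refine ⟨g * h, mul_mem hg hh, mul_ne_zero hgx hhx, fun y hy => ?_⟩
    exact ⟨hgS y (left_ne_zero_of_mul hy), hhT y (right_ne_zero_of_mul hy)⟩
  isOpen_sUnion := by
    intro 𝒲 h𝒲 a x hx
    obtain ⟨W, hW, hxW⟩ := hx
    obtain ⟨g, hg, hgx, hgW⟩ := h𝒲 W hW a x hxW
    exact ⟨g, hg, hgx, fun y hy => ⟨W, hW, hgW y hy⟩⟩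

/-- `φ` is a regular function on `W`: on every chart it is, near every point of `W`, a quotient
of two elements of the coordinate ring. (The values of `φ` outside `W` play no role.) -/
def IsRegularOn (𝒜 : ChartData X) (W : Set X) (φ : X → ℂ) : Prop :=
  ∀ (a : 𝒜.Chart) (x : 𝒜.pts a), 𝒜.incl a x ∈ W →
    ∃ f ∈ 𝒜.coord a, ∃ g ∈ 𝒜.coord a, g x ≠ 0 ∧
      ∀ y : 𝒜.pts a, 𝒜.incl a y ∈ W → g y ≠ 0 → φ (𝒜.incl a y) = f y / g y

/-- `e` is an isomorphism of varieties: a homeomorphism for the Zariski topologies that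
identifies the regular functions on every open set. -/
structure IsIso (𝒜 : ChartData X) (ℬ : ChartData Y) (e : X ≃ Y) : Prop where
  homeo : @IsHomeomorph X Y 𝒜.topology ℬ.topology e
  regular : ∀ W : Set Y, @IsOpen Y ℬ.topology W → ∀ φ : Y → ℂ,
    (ℬ.IsRegularOn W φ ↔ 𝒜.IsRegularOn (e ⁻¹' W) (φ ∘ e))

end ChartData

/-! ### Subvarieties of a product of projective lines -/

/-- The complex projective line; the point `(c : c')` is the class of the vector `![c, c']`. -/
abbrev CP1 : Type := Projectivization ℂ (Fin 2 → ℂ)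

/-- The affine coordinate of a point of `CP1` whose homogeneous coordinate number `e` does not
vanish: the other homogeneous coordinate divided by it. -/
noncomputable def affCoord (e : Fin 2) (q : CP1) : ℂ := q.rep (1 - e) / q.rep e

/-- The standard affine charts of `(CP1)^ι`, one for each choice `ε` of a homogeneous coordinate
in every factor: the points at which all the chosen coordinates are nonzero. -/
def affChart {ι : Type} (ε : ι → Fin 2) : Set (ι → CP1) := {p | ∀ i, (p i).rep (ε i) ≠ 0}

/-- The affine coordinates, in `ℂ^ι`, of a point of the chart `affChart ε`. -/
noncomputable def affCoords {ι : Type} (ε : ι → Fin 2) (p : ι → CP1) : ι → ℂ :=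
  fun i => affCoord (ε i) (p i)

/-- The structure of a variety on a closed subset `X` of `(CP1)^ι`: its charts are the
intersections with the standard affine charts, with coordinate rings generated by the affine
coordinates. -/
noncomputable def subvarietyCharts {ι : Type} (X : Set (ι → CP1)) : ChartData X where
  Chart := ι → Fin 2
  pts ε := {p : X // (p : ι → CP1) ∈ affChart ε}
  incl _ p := p.1
  coord ε := Algebra.adjoin ℂ (Set.range fun (i : ι) =>
    fun p : {p : X // (p : ι → CP1) ∈ affChart ε} => affCoords ε p.1.1 i)

/-- `X ⊆ (CP1)^ι` is smooth of dimension `d`: near each of its points `X` is, in affine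
coordinates, the zero set of `|ι| - d` polynomials whose differentials at the point are linearly
independent. -/
def IsSmoothOfDim {ι : Type} (d : ℕ) (X : Set (ι → CP1)) : Prop :=
  ∀ p ∈ X, ∃ ε : ι → Fin 2, p ∈ affChart ε ∧
    ∃ (r : ℕ) (f : Fin r → MvPolynomial ι ℂ) (g : MvPolynomial ι ℂ),
      r + d = Nat.card ι ∧
      MvPolynomial.eval (affCoords ε p) g ≠ 0 ∧
      (∀ q ∈ affChart ε, MvPolynomial.eval (affCoords ε q) g ≠ 0 →
        (q ∈ X ↔ ∀ k, MvPolynomial.eval (affCoords ε q) (f k) = 0)) ∧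
      LinearIndependent ℂ fun (k : Fin r) (i : ι) =>
        MvPolynomial.eval (affCoords ε p) (MvPolynomial.pderiv i (f k))

/-! ### The variety `F̄ₙ` and the torus action -/

/-- The pairs `(i, j)` with `3 ≤ i < j ≤ n`; there are `N = (n-2 choose 2)` of them. -/
abbrev Pairs (n : ℕ) : Type := {p : ℕ × ℕ // 3 ≤ p.1 ∧ p.1 < p.2 ∧ p.2 ≤ n}

/-- The variety `F̄ₙ ⊆ (CP1)^N`: the points `((c_ij : c'_ij))` with
`c_ij c'_ik c_jk = c'_ij c_ik c'_jk` for `3 ≤ i < j < k ≤ n`. The equations are homogeneous in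
each pair of homogeneous coordinates, so it does not matter which representatives are used. -/
def Fbar (n : ℕ) : Set (Pairs n → CP1) :=
  {c | ∀ (i j k : ℕ) (hi : 3 ≤ i) (hij : i < j) (hjk : j < k) (hk : k ≤ n),
    let cij := (c ⟨(i, j), hi, hij, hjk.le.trans hk⟩).rep
    let cik := (c ⟨(i, k), hi, hij.trans hjk, hk⟩).rep
    let cjk := (c ⟨(j, k), hi.trans hij.le, hjk, hk⟩).rep
    cij 0 * cik 1 * cjk 0 = cij 1 * cik 0 * cjk 1}

/-- The action of `z ∈ ℂ*` on `CP1`: `z · (c : c') = (z c : c')`. -/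
noncomputable def scaleCP1 (z : ℂˣ) : CP1 → CP1 :=
  Projectivization.map
    (LinearEquiv.piCongrRight fun a : Fin 2 =>
      LinearEquiv.smulOfUnit (R := ℂ) (M := ℂ) ((![z, 1] : Fin 2 → ℂˣ) a)).toLinearMap
    (LinearEquiv.injective _)

/-- The representation `ρ` of `(ℂ*)^(n-3)` in `(ℂ*)^N`, `t = (t_1, …, t_{n-3})`:
`ρ_{3k}(t) = t_{k-3}` for `4 ≤ k ≤ n` and `ρ_{ij}(t) = t_{j-3} / t_{i-3}` for `4 ≤ i < j ≤ n`.
(The parameter `t_l` is `t ⟨l - 1, _⟩` here.) -/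
def rho {n : ℕ} (t : Fin (n - 3) → ℂˣ) (p : Pairs n) : ℂˣ :=
  if h : p.1.1 = 3 then t ⟨p.1.2 - 4, by have := p.2; omega⟩
  else t ⟨p.1.2 - 4, by have := p.2; omega⟩ / t ⟨p.1.1 - 4, by have := p.2; omega⟩

/-- The action of `(ℂ*)^(n-3)` on `(CP1)^N` through `ρ`. -/
noncomputable def torusAct {n : ℕ} (t : Fin (n - 3) → ℂˣ) (c : Pairs n → CP1) :
    Pairs n → CP1 :=
  fun p => scaleCP1 (rho t p) (c p)

/-! ### The toric variety of a fan and of a lattice polytope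

`V` is a real vector space, `M` a lattice in `V`, and cones live in the dual space of `V`. -/

section Toric

variable {V : Type} [AddCommGroup V] [Module ℝ V] [TopologicalSpace V]

/-- The monoid `S_σ = σ^∨ ∩ M` of a cone `σ` in the dual space. -/
def dualMonoid (M : AddSubgroup V) (σ : Set (V →L[ℝ] ℝ)) : AddSubmonoid V where
  carrier := {m | m ∈ M ∧ ∀ u ∈ σ, 0 ≤ u m}
  zero_mem' := ⟨M.zero_mem, fun u _ => by simp⟩
  add_mem' := by
    rintro a b ⟨ha, ha'⟩ ⟨hb, hb'⟩
    exact ⟨M.add_mem ha hb, fun u hu => by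
      rw [map_add]; exact add_nonneg (ha' u hu) (hb' u hu)⟩

theorem dualMonoid_anti (M : AddSubgroup V) {τ σ : Set (V →L[ℝ] ℝ)} (h : τ ⊆ σ) :
    dualMonoid M σ ≤ dualMonoid M τ :=
  fun _ hm => ⟨hm.1, fun u hu => hm.2 u (h hu)⟩

/-- The points of the affine toric variety `U_σ = Spec ℂ[S_σ]`: monoid homomorphisms from `S_σ`
to the multiplicative monoid `ℂ`. -/
abbrev AffineToric (M : AddSubgroup V) (σ : Set (V →L[ℝ] ℝ)) : Type :=
  Multiplicative (dualMonoid M σ) →* ℂ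

/-- For `τ ⊆ σ`, the map `U_τ → U_σ` restricting homomorphisms from `S_τ` to `S_σ`. -/
def AffineToric.toLarger (M : AddSubgroup V) {τ σ : Set (V →L[ℝ] ℝ)} (h : τ ⊆ σ)
    (x : AffineToric M τ) : AffineToric M σ :=
  x.comp (AddMonoidHom.toMultiplicative (AddSubmonoid.inclusion (dualMonoid_anti M h)))

/-- The gluing of the affine toric varieties of a fan `Δ`: for cones `τ ⊆ σ` of the fan, `U_τ` is
identified with its image in `U_σ`. -/
def glueRel (M : AddSubgroup V) (Δ : Set (Set (V →L[ℝ] ℝ)))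
    (a b : Σ σ : Δ, AffineToric M σ.1) : Prop :=
  ∃ h : a.1.1 ⊆ b.1.1, b.2 = AffineToric.toLarger M h a.2

/-- The points of the toric variety of the fan `Δ`, with character lattice `M`. -/
def ToricVariety (M : AddSubgroup V) (Δ : Set (Set (V →L[ℝ] ℝ))) : Type :=
  Quot (glueRel M Δ)

/-- The variety structure on the toric variety of a fan: the charts are the `U_σ`, with
coordinate ring `ℂ[S_σ]`, generated by the functions `x ↦ x s` for `s ∈ S_σ`. -/
def toricCharts (M : AddSubgroup V) (Δ : Set (Set (V →L[ℝ] ℝ))) :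
    ChartData (ToricVariety M Δ) where
  Chart := Δ
  pts σ := AffineToric M σ.1
  incl σ x := Quot.mk _ ⟨σ, x⟩
  coord σ := Algebra.adjoin ℂ (Set.range fun (s : dualMonoid M σ.1) =>
    fun x : AffineToric M σ.1 => x (Multiplicative.ofAdd s))

/-- The torus with character lattice `M`. -/
abbrev Torus (M : AddSubgroup V) : Type := Multiplicative M →* ℂˣ

/-- The action of the torus on `U_σ`: `(t · x)(m) = t(m) x(m)`. -/
def AffineToric.act (M : AddSubgroup V) {σ : Set (V →L[ℝ] ℝ)} (t : Torus M)
    (x : AffineToric M σ) : AffineToric M σ where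
  toFun s := (t (Multiplicative.ofAdd ⟨s.toAdd.1, s.toAdd.2.1⟩) : ℂ) * x s
  map_one' := by
    have : t (Multiplicative.ofAdd (⟨0, M.zero_mem⟩ : M)) = 1 := t.map_one
    simp [this]
  map_mul' a b := by
    have h : t (Multiplicative.ofAdd
          (⟨(a * b).toAdd.1, (a * b).toAdd.2.1⟩ : M)) =
        t (Multiplicative.ofAdd ⟨a.toAdd.1, a.toAdd.2.1⟩) *
        t (Multiplicative.ofAdd ⟨b.toAdd.1, b.toAdd.2.1⟩) := by
      rw [← map_mul]; rfl
    rw [h, map_mul, Units.val_mul]; ring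

/-- The action of the torus on the toric variety of a fan. -/
def ToricVariety.act {M : AddSubgroup V} {Δ : Set (Set (V →L[ℝ] ℝ))} (t : Torus M) :
    ToricVariety M Δ → ToricVariety M Δ :=
  Quot.map (fun a => ⟨a.1, AffineToric.act M t a.2⟩) (by
    rintro ⟨τ, x⟩ ⟨σ, y⟩ ⟨h, hy⟩
    refine ⟨h, ?_⟩
    change y = AffineToric.toLarger M h x at hy
    change AffineToric.act M t y = AffineToric.toLarger M h (AffineToric.act M t x)
    rw [hy]
    rfl)

/-- The (inner) normal cone of a face `F` of `P`: the functionals that are minimal on `P`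
along `F`. -/
def normalCone (P F : Set V) : Set (V →L[ℝ] ℝ) := {u | ∀ p ∈ F, ∀ q ∈ P, u p ≤ u q}

/-- The normal fan of a polytope `P`: the normal cones of its nonempty faces. -/
def normalFan (P : Set V) : Set (Set (V →L[ℝ] ℝ)) :=
  {σ | ∃ F : Set V, F.Nonempty ∧ IsExposed ℝ P F ∧ σ = normalCone P F}

end Toric

/-! ### The permutohedral toric variety -/

/-- The permutohedron on `m` letters, of dimension `m - 1`: the convex hull of the points of
`ℝ^m` whose coordinates are `1, …, m` in some order. -/
def permutohedron (m : ℕ) : Set (Fin m → ℝ) :=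
  convexHull ℝ (Set.range fun (π : Equiv.Perm (Fin m)) (i : Fin m) => ((π i : ℕ) : ℝ) + 1)

/-- The lattice of the integer vectors in `ℝ^m` with coordinate sum zero: the integer points of
the linear hyperplane parallel to the permutohedron. -/
def rootLattice (m : ℕ) : AddSubgroup (Fin m → ℝ) where
  carrier := {v | (∀ i, ∃ k : ℤ, v i = k) ∧ ∑ i, v i = 0}
  zero_mem' := ⟨fun _ => ⟨0, by simp⟩, by simp⟩
  add_mem' := by
    rintro a b ⟨ha, ha'⟩ ⟨hb, hb'⟩
    refine ⟨fun i => ?_, by simp [Finset.sum_add_distrib, ha', hb']⟩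
    obtain ⟨k, hk⟩ := ha i
    obtain ⟨l, hl⟩ := hb i
    exact ⟨k + l, by simp [hk, hl]⟩
  neg_mem' := by
    rintro a ⟨ha, ha'⟩
    refine ⟨fun i => ?_, by simp [ha']⟩
    obtain ⟨k, hk⟩ := ha i
    exact ⟨-k, by simp [hk]⟩

/-- The points of the permutohedral toric variety: the toric variety of the normal fan of the
permutohedron on `m` letters. -/
abbrev PermutohedralVariety (m : ℕ) : Type :=
  ToricVariety (rootLattice m) (normalFan (permutohedron m))

/-- The variety structure on the permutohedral toric variety. -/
abbrev permutohedralCharts (m : ℕ) : ChartData (PermutohedralVariety m) :=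
  toricCharts (rootLattice m) (normalFan (permutohedron m))

/-- The homomorphism from `(ℂ*)^d` to the torus with character lattice `M` that an isomorphism
`M ≃ ℤ^d` of character lattices induces (it is an isomorphism of algebraic tori). -/
def torusOfLatticeIso {V : Type} [AddCommGroup V] {M : AddSubgroup V} {d : ℕ}
    (A : M ≃+ (Fin d → ℤ)) (t : Fin d → ℂˣ) : Multiplicative M →* ℂˣ where
  toFun m := ∏ l, t l ^ (A m.toAdd l)
  map_one' := by simp
  map_mul' a b := by simp [zpow_add, Finset.prod_mul_distrib]

end PermutohedralToric

open PermutohedralToric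

/-! Shift the indices to `0, …, d` with `d = n - 3`, and let `ratio p a b` be `c_ab / c'_ab` for `a
< b` and its inverse in the opposite direction. The equations of `F̄ₙ` then say that these ratios,
which may take the values `0` and `∞`, form a multiplicative cocycle (`mem_Fbar_iff`); on the open
orbit the ratio is `t_b / t_a` with `t_0 = 1`.

For a point of `F̄ₙ`, finiteness of `ratio p a b` is a total preorder on the indices
(`coef_ne_zero_trans`, `pointRank_le_iff`). By the rearrangement inequality, the cones of the normal
fan of the permutohedron are exactly the cones of functionals increasing along a total preorder
(`mem_normalFan_iff`), and the dual monoid of such a cone is generated by the roots `e_b - e_a` with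
`a ≤ b` in the preorder (`dualMonoid_orderCone_eq`). A point of the affine toric chart is thus the
same as a system of finite ratios satisfying the cocycle rule (`affineToric_ext`,
`exists_affineToric_of_point`). Gluing gives the bijection `equivToric`. It is regular both ways
because the coordinates on both sides are ratios, and equivariant because the root `e_b - e_a` is
the character `t_b / t_a`.

Smoothness and irreducibility are read off in the charts of linear orders, which cover `F̄ₙ`. There
`F̄ₙ` is the graph over `ℂ^d` of a polynomial map: the ratios of consecutive indices are free, and
every other coordinate is a product of them (`mem_Fbar_iff_affCoords`). -/

namespace PermutohedralToric

/-! ### Points of `F̄ₙ` as cocycles of ratios, and their total preorders. -/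

section HomogeneousCoordinates

variable {d : ℕ}

theorem CP1.ext_cross {q q' : CP1} (h : q.rep 0 * q'.rep 1 = q.rep 1 * q'.rep 0) : q = q' := by
  rw [← q.mk_rep, ← q'.mk_rep, Projectivization.mk_eq_mk_iff']
  have hq' := q'.rep_nonzero
  have key : q'.rep 0 ≠ 0 ∨ q'.rep 1 ≠ 0 := by
    by_contra hc
    push Not at hc
    exact hq' (by ext i; fin_cases i; exacts [hc.1, hc.2])
  rcases key with h0 | h1
  · refine ⟨q.rep 0 / q'.rep 0, ?_⟩
    ext i
    fin_cases i
    · simp [h0]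
    · simp only [Pi.smul_apply, smul_eq_mul, Fin.mk_one]
      field_simp
      linear_combination h
  · refine ⟨q.rep 1 / q'.rep 1, ?_⟩
    ext i
    fin_cases i
    · simp only [Pi.smul_apply, smul_eq_mul, Fin.zero_eta]
      field_simp
      linear_combination -h
    · simp [h1]

theorem CP1.rep_ne_zero (q : CP1) : q.rep 0 ≠ 0 ∨ q.rep 1 ≠ 0 := by
  by_contra hc
  push Not at hc
  exact q.rep_nonzero (by ext i; fin_cases i; exacts [hc.1, hc.2])

theorem CP1.rep_mk (v : Fin 2 → ℂ) (hv : v ≠ 0) :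
    ∃ z : ℂ, z ≠ 0 ∧ ∀ i, (Projectivization.mk ℂ v hv).rep i = z * v i := by
  obtain ⟨a, ha⟩ := Projectivization.exists_smul_eq_mk_rep ℂ v hv
  exact ⟨a, a.ne_zero, fun i => by rw [← ha]; rfl⟩

theorem scaleCP1_rep (z : ℂˣ) (q : CP1) :
    ∃ l : ℂ, l ≠ 0 ∧ (scaleCP1 z q).rep 0 = l * (z * q.rep 0) ∧
      (scaleCP1 z q).rep 1 = l * q.rep 1 := by
  have h : scaleCP1 z q = Projectivization.mk ℂ ![(z : ℂ) * q.rep 0, q.rep 1] (by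
      intro h
      have h0 := congrFun h 0
      have h1 := congrFun h 1
      rcases q.rep_ne_zero with hq | hq <;> simp_all) := by
    conv_lhs => rw [← q.mk_rep]
    rw [scaleCP1, Projectivization.map_mk, Projectivization.mk_eq_mk_iff']
    refine ⟨1, ?_⟩
    ext i
    fin_cases i <;> simp [LinearEquiv.smulOfUnit]
    rfl
  obtain ⟨l, hl, hl'⟩ := CP1.rep_mk _ (show ![(z : ℂ) * q.rep 0, q.rep 1] ≠ 0 by
      intro h
      have h0 := congrFun h 0
      have h1 := congrFun h 1
      rcases q.rep_ne_zero with hq | hq <;> simp_all)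
  rw [h]
  exact ⟨l, hl, hl' 0, hl' 1⟩

/-- The pair of indices `(a + 3, b + 3)`. -/
def pairOf (a b : Fin (d + 1)) (h : a < b) : Pairs (d + 3) :=
  ⟨(a + 3, b + 3), by have := b.2; have : (a : ℕ) < b := h; dsimp only; omega⟩

/-- The first index of a pair, shifted to start at zero. -/
def Pairs.fst (P : Pairs (d + 3)) : Fin (d + 1) := ⟨P.1.1 - 3, by have := P.2; omega⟩

/-- The second index of a pair, shifted to start at zero. -/
def Pairs.snd (P : Pairs (d + 3)) : Fin (d + 1) := ⟨P.1.2 - 3, by have := P.2; omega⟩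

theorem Pairs.fst_lt_snd (P : Pairs (d + 3)) : Pairs.fst P < Pairs.snd P := by
  have := P.2
  simp only [fst, snd, Fin.lt_def]
  omega

theorem pairOf_fst_snd (P : Pairs (d + 3)) :
    pairOf (Pairs.fst P) (Pairs.snd P) P.fst_lt_snd = P := by
  obtain ⟨⟨i, j⟩, h⟩ := P
  simp only [pairOf, Pairs.fst, Pairs.snd, Subtype.mk.injEq, Prod.mk.injEq]
  dsimp only at h
  omega

@[simp] theorem fst_pairOf (a b : Fin (d + 1)) (h : a < b) : Pairs.fst (pairOf a b h) = a := by
  ext; simp [pairOf, Pairs.fst]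

@[simp] theorem snd_pairOf (a b : Fin (d + 1)) (h : a < b) : Pairs.snd (pairOf a b h) = b := by
  ext; simp [pairOf, Pairs.snd]

/-- The homogeneous coordinate `c_ab` for `a < b`, and `c'_ba` for `b < a`. -/
noncomputable def coef (p : Pairs (d + 3) → CP1) (a b : Fin (d + 1)) : ℂ :=
  if h : a < b then (p (pairOf a b h)).rep 0
  else if h : b < a then (p (pairOf b a h)).rep 1 else 1

/-- The ratio of homogeneous coordinates, equal to `t_b / t_a` on the torus. -/
noncomputable def ratio (p : Pairs (d + 3) → CP1) (a b : Fin (d + 1)) : ℂ :=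
  coef p a b / coef p b a

variable {p q : Pairs (d + 3) → CP1} {a b c : Fin (d + 1)}

theorem coef_of_lt (h : a < b) : coef p a b = (p (pairOf a b h)).rep 0 := by simp [coef, h]

theorem coef_of_gt (h : a < b) : coef p b a = (p (pairOf a b h)).rep 1 := by
  simp [coef, h, h.not_gt]

@[simp] theorem coef_self (p : Pairs (d + 3) → CP1) (a : Fin (d + 1)) : coef p a a = 1 := by
  simp [coef]

@[simp] theorem ratio_self (p : Pairs (d + 3) → CP1) (a : Fin (d + 1)) : ratio p a a = 1 := by
  simp [ratio]

theorem ratio_inv (p : Pairs (d + 3) → CP1) (a b : Fin (d + 1)) :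
    (ratio p a b)⁻¹ = ratio p b a := by
  simp [ratio]

theorem coef_ne_zero_or (p : Pairs (d + 3) → CP1) (a b : Fin (d + 1)) :
    coef p a b ≠ 0 ∨ coef p b a ≠ 0 := by
  rcases lt_trichotomy a b with h | rfl | h
  · rw [coef_of_lt h, coef_of_gt h]; exact CP1.rep_ne_zero _
  · simp
  · rw [coef_of_lt h, coef_of_gt h]; exact (CP1.rep_ne_zero _).symm

theorem point_ext (h : ∀ a b, a < b → coef p a b * coef q b a = coef p b a * coef q a b) :
    p = q := by
  funext P
  rw [← pairOf_fst_snd P]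
  have := h _ _ P.fst_lt_snd
  rw [coef_of_lt P.fst_lt_snd, coef_of_lt P.fst_lt_snd, coef_of_gt P.fst_lt_snd,
    coef_of_gt P.fst_lt_snd] at this
  exact CP1.ext_cross this

theorem point_ext_ratio (h : ∀ a b, (coef p b a ≠ 0 ∧ coef q b a ≠ 0 ∧ ratio p a b = ratio q a b) ∨
    (coef p a b ≠ 0 ∧ coef q a b ≠ 0 ∧ ratio p b a = ratio q b a)) : p = q := by
  refine point_ext fun a b _ => ?_
  rcases h a b with ⟨h1, h2, h3⟩ | ⟨h1, h2, h3⟩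
  · rw [ratio, ratio, div_eq_div_iff h1 h2] at h3
    linear_combination h3
  · rw [ratio, ratio, div_eq_div_iff h1 h2] at h3
    linear_combination -h3

/-- With the primed coordinate written as `coef` in reversed order, a permutation of `a, b, c` at
most exchanges the two sides of the equation, and the equation is trivial when two indices agree
since `coef p a a = 1`. The restriction to increasing triples can therefore be dropped. -/
theorem mem_Fbar_iff : p ∈ Fbar (d + 3) ↔ ∀ a b c : Fin (d + 1),
    coef p a b * coef p b c * coef p c a = coef p b a * coef p c b * coef p a c := by
  constructor
  · intro hp
    have H : ∀ a b c : Fin (d + 1), a < b → b < c →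
        coef p a b * coef p b c * coef p c a = coef p b a * coef p c b * coef p a c := by
      intro a b c hab hbc
      have := hp (a + 3) (b + 3) (c + 3) (by omega) (by simpa using hab) (by simpa using hbc)
        (by have := c.2; omega)
      rw [coef_of_lt hab, coef_of_lt hbc, coef_of_gt (hab.trans hbc), coef_of_gt hab,
        coef_of_gt hbc, coef_of_lt (hab.trans hbc)]
      dsimp only at this
      simp only [pairOf]
      linear_combination this
    intro a b c
    rcases eq_or_ne a b with rfl | hab
    · simp only [coef_self]; ring
    rcases eq_or_ne b c with rfl | hbc
    · simp only [coef_self]; ring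
    rcases eq_or_ne a c with rfl | hac
    · simp only [coef_self]; ring
    rcases lt_or_gt_of_ne hab with h1 | h1 <;> rcases lt_or_gt_of_ne hbc with h2 | h2 <;>
      rcases lt_or_gt_of_ne hac with h3 | h3
    · exact H _ _ _ h1 h2
    · exact absurd (h1.trans h2) h3.not_gt
    · linear_combination -(H _ _ _ h3 h2)
    · linear_combination H _ _ _ h3 h1
    · linear_combination -(H _ _ _ h1 h3)
    · linear_combination H _ _ _ h2 h3
    · exact absurd (h2.trans h1) h3.not_gt
    · linear_combination -(H _ _ _ h2 h1)
  · intro H i j k hi hij hjk hk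
    have hab : (⟨i - 3, by omega⟩ : Fin (d + 1)) < ⟨j - 3, by omega⟩ := by
      rw [Fin.lt_def]; dsimp only; omega
    have hbc : (⟨j - 3, by omega⟩ : Fin (d + 1)) < ⟨k - 3, by omega⟩ := by
      rw [Fin.lt_def]; dsimp only; omega
    have := H ⟨i - 3, by omega⟩ ⟨j - 3, by omega⟩ ⟨k - 3, by omega⟩
    rw [coef_of_lt hab, coef_of_lt hbc, coef_of_gt (hab.trans hbc), coef_of_gt hab,
        coef_of_gt hbc, coef_of_lt (hab.trans hbc)] at this
    have e1 : i - 3 + 3 = i := by omega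
    have e2 : j - 3 + 3 = j := by omega
    have e3 : k - 3 + 3 = k := by omega
    simp only [pairOf, e1, e2, e3] at this
    dsimp only
    linear_combination this

theorem ratio_mul_ratio (hp : p ∈ Fbar (d + 3)) (hab : coef p b a ≠ 0) (hbc : coef p c b ≠ 0)
    (hac : coef p c a ≠ 0) : ratio p a b * ratio p b c = ratio p a c := by
  have := mem_Fbar_iff.1 hp a b c
  rw [ratio, ratio, ratio]
  field_simp
  linear_combination this

/-- Transitivity of "`ratio p a b` is finite": if `coef p c a` vanished, so would the left side of
the cocycle equation, while the right side would be a product of nonzero factors. -/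
theorem coef_ne_zero_trans (hp : p ∈ Fbar (d + 3)) (hab : coef p b a ≠ 0) (hbc : coef p c b ≠ 0) :
    coef p c a ≠ 0 := by
  intro h
  have h' := (coef_ne_zero_or p a c).resolve_right (by simpa using h)
  have := mem_Fbar_iff.1 hp a b c
  rw [h] at this
  simp_all

/-- By the same symmetry, one ordering of each triple suffices, and it may be taken increasing for
`u`, where all the ratios involved are finite. -/
theorem mem_Fbar_of_ratio {u : Fin (d + 1) → ℝ} (hu : ∀ a b, u a ≤ u b → coef p b a ≠ 0)
    (H : ∀ a b c, u a ≤ u b → u b ≤ u c → ratio p a b * ratio p b c = ratio p a c) :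
    p ∈ Fbar (d + 3) := by
  have K : ∀ a b c, u a ≤ u b → u b ≤ u c →
      coef p a b * coef p b c * coef p c a = coef p b a * coef p c b * coef p a c := by
    intro a b c h1 h2
    have := H a b c h1 h2
    have n1 := hu _ _ h1
    have n2 := hu _ _ h2
    have n3 := hu _ _ (h1.trans h2)
    rw [ratio, ratio, ratio] at this
    field_simp at this
    linear_combination this
  rw [mem_Fbar_iff]
  intro a b c
  rcases le_total (u a) (u b) with h1 | h1 <;> rcases le_total (u b) (u c) with h2 | h2 <;>
    rcases le_total (u a) (u c) with h3 | h3
  · exact K _ _ _ h1 h2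
  · exact K _ _ _ h1 h2
  · linear_combination -(K _ _ _ h3 h2)
  · linear_combination K _ _ _ h3 h1
  · linear_combination -(K _ _ _ h1 h3)
  · linear_combination K _ _ _ h2 h3
  · linear_combination -(K _ _ _ h2 h1)
  · linear_combination -(K _ _ _ h2 h1)

open Classical in
/-- The rank of an index in the total preorder attached to a point. -/
noncomputable def pointRank (p : Pairs (d + 3) → CP1) (a : Fin (d + 1)) : ℝ :=
  ((Finset.univ.filter fun c => coef p a c ≠ 0).card : ℝ)

/-- The set counted by `pointRank` is the down-set of `a`. Down-sets of a total preorder are nested,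
so their cardinalities compare them; this realizes the preorder by a real function, as `orderCone`
requires. -/
theorem pointRank_le_iff (hp : p ∈ Fbar (d + 3)) :
    pointRank p a ≤ pointRank p b ↔ coef p b a ≠ 0 := by
  classical
  have mono : ∀ a b, coef p b a ≠ 0 → (Finset.univ.filter fun c => coef p a c ≠ 0) ⊆
      Finset.univ.filter fun c => coef p b c ≠ 0 := by
    intro a b h c hc
    simp only [Finset.mem_filter, Finset.mem_univ, true_and] at hc ⊢
    exact coef_ne_zero_trans hp hc h
  rw [pointRank, pointRank, Nat.cast_le]
  constructor
  · intro h hba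
    have hab := (coef_ne_zero_or p a b).resolve_right (by simpa using hba)
    have := Finset.card_lt_card (s := Finset.univ.filter fun c => coef p b c ≠ 0)
      (t := Finset.univ.filter fun c => coef p a c ≠ 0) ⟨mono _ _ hab, fun hs => by
        have : a ∈ Finset.univ.filter fun c => coef p b c ≠ 0 := hs (by simp)
        simp [hba] at this⟩
    exact absurd h (by convert this.not_ge)
  · intro h
    convert Finset.card_le_card (mono _ _ h)

/-- The torus coordinates with a `1` put in front. -/
def extendOne (t : Fin d → ℂˣ) (a : Fin (d + 1)) : ℂˣ := Fin.cons (α := fun _ => ℂˣ) 1 t a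

theorem rho_pairOf (t : Fin d → ℂˣ) (h : a < b) :
    rho (n := d + 3) t (pairOf a b h) = extendOne t b / extendOne t a := by
  obtain ⟨b', rfl⟩ := Fin.exists_succ_eq.2 (Fin.ne_zero_of_lt h)
  rcases Fin.eq_zero_or_eq_succ a with rfl | ⟨a', rfl⟩
  · rw [rho, dif_pos (by simp [pairOf])]
    simp only [extendOne, Fin.cons_succ, Fin.cons_zero, div_one]
    congr 1
  · rw [rho, dif_neg (by simp [pairOf])]
    simp only [extendOne, Fin.cons_succ]
    congr 1

theorem coef_torusAct (t : Fin d → ℂˣ) (p : Pairs (d + 3) → CP1) (a b : Fin (d + 1)) :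
    ∃ l : ℂ, l ≠ 0 ∧ coef (torusAct (n := d + 3) t p) a b = l * extendOne t b * coef p a b ∧
      coef (torusAct (n := d + 3) t p) b a = l * extendOne t a * coef p b a := by
  have key : ∀ a b : Fin (d + 1), a < b → ∃ l : ℂ, l ≠ 0 ∧
      coef (torusAct (n := d + 3) t p) a b = l * extendOne t b * coef p a b ∧
      coef (torusAct (n := d + 3) t p) b a = l * extendOne t a * coef p b a := by
    intro a b h
    obtain ⟨l, hl, h0, h1⟩ := scaleCP1_rep (rho (n := d + 3) t (pairOf a b h)) (p (pairOf a b h))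
    -- Dividing by `t_a` turns the weights `(t_b / t_a, 1)` into the symmetric pair `(t_b, t_a)`.
    refine ⟨l / extendOne t a, div_ne_zero hl (Units.ne_zero _), ?_, ?_⟩
    · rw [coef_of_lt h, coef_of_lt h, torusAct, h0, rho_pairOf]
      simp only [Units.val_div_eq_div_val]
      ring
    · rw [coef_of_gt h, coef_of_gt h, torusAct, h1]
      have := (extendOne t a).ne_zero
      field_simp
  rcases lt_trichotomy a b with h | rfl | h
  · exact key _ _ h
  · have := (extendOne t a).ne_zero
    refine ⟨(extendOne t a : ℂ)⁻¹, inv_ne_zero this, ?_, ?_⟩ <;> simp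
  · obtain ⟨l, hl, h1, h2⟩ := key _ _ h
    exact ⟨l, hl, h2, h1⟩

theorem coef_torusAct_ne_zero (t : Fin d → ℂˣ) :
    coef (torusAct (n := d + 3) t p) a b ≠ 0 ↔ coef p a b ≠ 0 := by
  obtain ⟨l, hl, h, -⟩ := coef_torusAct t p a b
  rw [h]
  simp [hl]

theorem ratio_torusAct (t : Fin d → ℂˣ) :
    ratio (torusAct (n := d + 3) t p) a b = extendOne t b / extendOne t a * ratio p a b := by
  obtain ⟨l, hl, h1, h2⟩ := coef_torusAct t p a b
  rw [ratio, h1, h2, ratio, mul_assoc, mul_assoc, mul_div_mul_left _ _ hl, mul_div_mul_comm]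

theorem torusAct_mem_Fbar (t : Fin d → ℂˣ) (hp : p ∈ Fbar (d + 3)) :
    torusAct (n := d + 3) t p ∈ Fbar (d + 3) := by
  refine mem_Fbar_of_ratio (u := pointRank p) (fun a b h => ?_) fun a b c hab hbc => ?_
  · rw [coef_torusAct_ne_zero]
    exact (pointRank_le_iff hp).1 h
  · rw [ratio_torusAct, ratio_torusAct, ratio_torusAct, ← ratio_mul_ratio (b := b) hp
      ((pointRank_le_iff hp).1 hab) ((pointRank_le_iff hp).1 hbc)
      ((pointRank_le_iff hp).1 (hab.trans hbc))]
    have := (extendOne t b).ne_zero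
    field_simp

end HomogeneousCoordinates

/-! ### The normal fan of the permutohedron. -/

section BraidFan

variable {m : ℕ}

/-- The cone of the functionals that are weakly increasing along the total preorder of `u`. -/
def orderCone (u : Fin m → ℝ) : Set ((Fin m → ℝ) →L[ℝ] ℝ) :=
  {v | ∀ a b, u a ≤ u b → v (Pi.single a 1) ≤ v (Pi.single b 1)}

/-- The functional with coefficients `u`. -/
noncomputable def functionalOf (u : Fin m → ℝ) : (Fin m → ℝ) →L[ℝ] ℝ :=
  ∑ a, u a • ContinuousLinearMap.proj a

theorem functionalOf_apply (u x : Fin m → ℝ) : functionalOf u x = ∑ a, u a * x a := by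
  simp [functionalOf]

theorem functionalOf_single (u : Fin m → ℝ) (a : Fin m) :
    functionalOf u (Pi.single a 1) = u a := by
  rw [functionalOf_apply, Finset.sum_eq_single a] <;> simp +contextual

theorem functionalOf_eval (v : (Fin m → ℝ) →L[ℝ] ℝ) :
    functionalOf (fun a => v (Pi.single a 1)) = v := by
  ext x
  rw [functionalOf_apply]
  have := LinearMap.pi_apply_eq_sum_univ v.toLinearMap x
  simp only [ContinuousLinearMap.coe_coe, smul_eq_mul] at this
  rw [this]
  refine Finset.sum_congr rfl fun a _ => ?_
  rw [mul_comm]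
  congr 2
  ext j
  simp [Pi.single_apply, eq_comm]

theorem functionalOf_mem_orderCone {u v : Fin m → ℝ} :
    functionalOf v ∈ orderCone u ↔ ∀ a b, u a ≤ u b → v a ≤ v b := by
  simp [orderCone, functionalOf_single]

/-- The vertex of the permutohedron given by a permutation. -/
def vertex (π : Equiv.Perm (Fin m)) (i : Fin m) : ℝ := ((π i : ℕ) : ℝ) + 1

theorem vertex_mul (π σ : Equiv.Perm (Fin m)) : vertex (π * σ) = vertex π ∘ σ := rfl

theorem functionalOf_vertex_swap (u : Fin m → ℝ) (π : Equiv.Perm (Fin m)) {i j : Fin m}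
    (hij : i ≠ j) : functionalOf u (vertex (π * Equiv.swap i j)) =
      functionalOf u (vertex π) + (u i - u j) * (vertex π j - vertex π i) := by
  rw [← sub_eq_iff_eq_add', functionalOf_apply, functionalOf_apply, ← Finset.sum_sub_distrib,
    Fintype.sum_eq_add i j hij]
  · simp only [vertex_mul, Function.comp_apply, Equiv.swap_apply_left, Equiv.swap_apply_right]
    ring
  · rintro k ⟨hi, hj⟩
    simp [vertex_mul, Equiv.swap_apply_of_ne_of_ne hi hj]

/-- The rearrangement inequality: oppositely ordered sequences minimize the scalar product. -/
theorem functionalOf_vertex_le {u : Fin m → ℝ} {π : Equiv.Perm (Fin m)}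
    (h : Antivary u (vertex π)) (σ : Equiv.Perm (Fin m)) :
    functionalOf u (vertex π) ≤ functionalOf u (vertex σ) := by
  have := h.sum_smul_le_sum_smul_comp_perm (σ := π⁻¹ * σ)
  rw [functionalOf_apply, functionalOf_apply]
  simpa [vertex] using this

theorem exists_antivary_vertex (u : Fin m → ℝ) :
    ∃ π : Equiv.Perm (Fin m), Antivary u (vertex π) := by
  obtain ⟨π, hπ⟩ := Finite.exists_min fun π : Equiv.Perm (Fin m) => functionalOf u (vertex π)
  refine ⟨π, fun i j hij => ?_⟩
  by_contra! hu
  have hne : i ≠ j := by rintro rfl; exact lt_irrefl _ hij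
  have := hπ (π * Equiv.swap i j)
  rw [functionalOf_vertex_swap u π hne] at this
  nlinarith

theorem antivary_of_functionalOf_vertex_eq {u : Fin m → ℝ} {π σ : Equiv.Perm (Fin m)}
    (h : Antivary u (vertex π)) (hσ : functionalOf u (vertex σ) = functionalOf u (vertex π)) :
    Antivary u (vertex σ) := by
  intro i j hij
  by_contra! hu
  have hne : i ≠ j := by rintro rfl; exact lt_irrefl _ hij
  have := functionalOf_vertex_le h (σ * Equiv.swap i j)
  rw [functionalOf_vertex_swap u σ hne, hσ] at this
  nlinarith

/-- A minimizing vertex can have the wrong order at `i, j` only when `u i = u j`, and then swapping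
the two values keeps it minimizing. -/
theorem exists_antivary_vertex_lt (u : Fin m → ℝ) {i j : Fin m} (hne : i ≠ j) (h : u i ≤ u j) :
    ∃ π : Equiv.Perm (Fin m), Antivary u (vertex π) ∧ vertex π j < vertex π i := by
  obtain ⟨π, hπ⟩ := exists_antivary_vertex u
  have hv : vertex π i ≠ vertex π j := by simpa [vertex, Fin.val_inj] using hne
  rcases lt_or_gt_of_ne hv with hlt | hlt
  · refine ⟨π * Equiv.swap i j, antivary_of_functionalOf_vertex_eq hπ ?_, ?_⟩
    · rw [functionalOf_vertex_swap u π hne, le_antisymm h (hπ hlt)]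
      ring
    · simpa [vertex_mul] using hlt
  · exact ⟨π, hπ, hlt⟩

theorem vertex_mem (π : Equiv.Perm (Fin m)) : vertex π ∈ permutohedron m :=
  subset_convexHull ℝ _ ⟨π, rfl⟩

theorem le_functionalOf_of_antivary {u : Fin m → ℝ} {π : Equiv.Perm (Fin m)}
    (h : Antivary u (vertex π)) {x : Fin m → ℝ} (hx : x ∈ permutohedron m) :
    functionalOf u (vertex π) ≤ functionalOf u x := by
  have : permutohedron m ⊆ {x | functionalOf u (vertex π) ≤ functionalOf u x} := by
    refine convexHull_min ?_ (convex_halfSpace_ge (functionalOf u).toLinearMap.isLinear _)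
    rintro _ ⟨σ, rfl⟩
    exact functionalOf_vertex_le h σ
  exact this hx

theorem exists_weights {x : Fin m → ℝ} (hx : x ∈ permutohedron m) :
    ∃ w : Equiv.Perm (Fin m) → ℝ, (∀ π, 0 ≤ w π) ∧ ∑ π, w π = 1 ∧ ∑ π, w π • vertex π = x := by
  have : permutohedron m ⊆ {x | ∃ w : Equiv.Perm (Fin m) → ℝ,
      (∀ π, 0 ≤ w π) ∧ ∑ π, w π = 1 ∧ ∑ π, w π • vertex π = x} := by
    refine convexHull_min ?_ ?_
    · rintro _ ⟨σ, rfl⟩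
      refine ⟨Pi.single σ 1, fun π => ?_, by simp, ?_⟩
      · rw [Pi.single_apply]; split_ifs <;> simp
      · rw [Finset.sum_eq_single σ] <;> simp +contextual
        rfl
    · rintro x ⟨w, hw0, hw1, rfl⟩ y ⟨v, hv0, hv1, rfl⟩ a b ha hb hab
      refine ⟨fun π => a * w π + b * v π, fun π => ?_, ?_, ?_⟩
      · have := hw0 π; have := hv0 π; positivity
      · rw [Finset.sum_add_distrib, ← Finset.mul_sum, ← Finset.mul_sum, hw1, hv1, mul_one, mul_one,
          hab]
      · simp only [add_smul, mul_smul, Finset.sum_add_distrib, Finset.smul_sum]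
  exact this hx

/-- The face of the permutohedron on which a functional is minimal. -/
def minFace (u : Fin m → ℝ) : Set (Fin m → ℝ) :=
  {x ∈ permutohedron m | ∀ y ∈ permutohedron m, functionalOf u x ≤ functionalOf u y}

theorem vertex_mem_minFace {u : Fin m → ℝ} {π : Equiv.Perm (Fin m)} (h : Antivary u (vertex π)) :
    vertex π ∈ minFace u :=
  ⟨vertex_mem π, fun _ hy => le_functionalOf_of_antivary h hy⟩

/-- For one inclusion, comparing a minimizing vertex with its transposition at `i, j` forces the
inequality between the two coefficients of `v`. For the other, a point of the face is a convex
combination of vertices minimizing `u`; these are ordered oppositely to `u`, hence to `v`, so `v` is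
minimal at each of them. -/
theorem normalCone_minFace (u : Fin m → ℝ) :
    normalCone (permutohedron m) (minFace u) = orderCone u := by
  ext v
  constructor
  · intro hv i j hij
    rcases eq_or_ne i j with rfl | hne
    · exact le_rfl
    obtain ⟨π, hπ, hlt⟩ := exists_antivary_vertex_lt u hne hij
    have := hv _ (vertex_mem_minFace hπ) _ (vertex_mem (π * Equiv.swap i j))
    rw [← functionalOf_eval v, functionalOf_vertex_swap _ π hne] at this
    nlinarith
  · intro hv x hx y hy
    obtain ⟨π, hπ⟩ := exists_antivary_vertex u
    have anti : ∀ σ : Equiv.Perm (Fin m), Antivary u (vertex σ) →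
        Antivary (fun a => v (Pi.single a 1)) (vertex σ) := fun σ hσ i j hij => hv _ _ (hσ hij)
    obtain ⟨w, hw0, hw1, rfl⟩ := exists_weights hx.1
    have hle := le_functionalOf_of_antivary (anti π hπ) hy
    have hu := hx.2 _ (vertex_mem π)
    rw [functionalOf_eval] at hle
    refine le_trans (le_of_eq ?_) hle
    -- Nonnegative terms with nonpositive sum: only vertices minimizing `u` carry weight.
    have hz : ∀ σ, w σ * (functionalOf u (vertex σ) - functionalOf u (vertex π)) = 0 := by
      have hnn : ∀ σ ∈ Finset.univ,
          0 ≤ w σ * (functionalOf u (vertex σ) - functionalOf u (vertex π)) := fun σ _ =>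
        mul_nonneg (hw0 σ) (sub_nonneg.2 (functionalOf_vertex_le hπ σ))
      have hs : ∑ σ, w σ * (functionalOf u (vertex σ) - functionalOf u (vertex π)) = 0 := by
        refine le_antisymm ?_ (Finset.sum_nonneg hnn)
        simp only [mul_sub, Finset.sum_sub_distrib, ← Finset.sum_mul, hw1]
        simpa [map_sum] using hu
      exact fun σ => (Finset.sum_eq_zero_iff_of_nonneg hnn).1 hs σ (Finset.mem_univ _)
    have hterm : ∀ σ, w σ * v (vertex σ) = w σ * v (vertex π) := by
      intro σ
      rcases mul_eq_zero.1 (hz σ) with h | h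
      · simp [h]
      · have hσ := antivary_of_functionalOf_vertex_eq hπ (sub_eq_zero.1 h)
        have h1 := functionalOf_vertex_le (anti σ hσ) π
        have h2 := functionalOf_vertex_le (anti π hπ) σ
        rw [functionalOf_eval] at h1 h2
        rw [le_antisymm h1 h2]
    rw [map_sum]
    simp only [map_smul, smul_eq_mul, hterm]
    rw [← Finset.sum_mul, hw1, one_mul]

theorem mem_normalFan_iff {σ : Set ((Fin m → ℝ) →L[ℝ] ℝ)} :
    σ ∈ normalFan (permutohedron m) ↔ ∃ u : Fin m → ℝ, σ = orderCone u := by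
  constructor
  · rintro ⟨F, hF, hexp, rfl⟩
    obtain ⟨l, rfl⟩ := hexp hF
    -- Exposed faces are loci of maxima and `minFace` is a locus of minima, hence the sign.
    refine ⟨fun a => (-l) (Pi.single a 1), ?_⟩
    rw [← normalCone_minFace]
    congr 1
    ext x
    simp only [minFace, functionalOf_eval]
    simp
  · rintro ⟨u, rfl⟩
    refine ⟨minFace u, ?_, fun _ => ⟨-functionalOf u, ?_⟩, (normalCone_minFace u).symm⟩
    · obtain ⟨π, hπ⟩ := exists_antivary_vertex u
      exact ⟨_, vertex_mem_minFace hπ⟩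
    · ext x
      simp [minFace]

end BraidFan

/-! ### Roots generate the dual monoids; homomorphisms as cocycles of ratios. -/

section DualMonoid

variable {d : ℕ}

/-- The difference of two basis vectors. -/
def root {m : ℕ} (a b : Fin m) : Fin m → ℝ := Pi.single b 1 - Pi.single a 1

theorem root_self {m : ℕ} (a : Fin m) : root a a = 0 := sub_self _

theorem root_add_root {m : ℕ} (a b c : Fin m) : root a b + root b c = root a c := by
  simp [root]

theorem root_mem_rootLattice {m : ℕ} (a b : Fin m) : root a b ∈ rootLattice m := by
  refine ⟨fun i => ⟨(if i = b then 1 else 0) - if i = a then 1 else 0, ?_⟩, ?_⟩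
  · simp [root, Pi.single_apply]
  · simp [root]

theorem root_mem_dualMonoid {m : ℕ} {u : Fin m → ℝ} {a b : Fin m} :
    root a b ∈ dualMonoid (rootLattice m) (orderCone u) ↔ u a ≤ u b := by
  constructor
  · intro h
    have := h.2 (functionalOf u) (functionalOf_mem_orderCone.2 fun _ _ => id)
    rw [root, map_sub, functionalOf_single, functionalOf_single] at this
    linarith
  · intro h
    refine ⟨root_mem_rootLattice a b, fun v hv => ?_⟩
    rw [root, map_sub]
    exact sub_nonneg.2 (hv _ _ h)

/-- The sum of the coordinates after position `l`, in the order given by `w`. -/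
def tailSum (w : Equiv.Perm (Fin (d + 1))) (l : Fin d) (s : Fin (d + 1) → ℝ) : ℝ :=
  ∑ k, if l.castSucc < k then s (w k) else 0

theorem tailSum_add (w : Equiv.Perm (Fin (d + 1))) (l : Fin d) (s s' : Fin (d + 1) → ℝ) :
    tailSum w l (s + s') = tailSum w l s + tailSum w l s' := by
  rw [tailSum, tailSum, tailSum, ← Finset.sum_add_distrib]
  refine Finset.sum_congr rfl fun k _ => ?_
  split_ifs <;> simp

theorem tailSum_zero (w : Equiv.Perm (Fin (d + 1))) (l : Fin d) : tailSum w l 0 = 0 := by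
  simp [tailSum]

theorem tailSum_root (w : Equiv.Perm (Fin (d + 1))) (l : Fin d) (a b : Fin (d + 1)) :
    tailSum w l (root (w a) (w b)) =
      (if l.castSucc < b then 1 else 0) - if l.castSucc < a then 1 else 0 := by
  rw [tailSum, ← Finset.sum_filter]
  simp [root, Pi.single_apply]

theorem tailSum_int (w : Equiv.Perm (Fin (d + 1))) (l : Fin d) {s : Fin (d + 1) → ℝ}
    (hs : s ∈ rootLattice (d + 1)) : ∃ k : ℤ, tailSum w l s = k := by
  choose k hk using hs.1
  refine ⟨∑ j, if l.castSucc < j then k (w j) else 0, ?_⟩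
  rw [tailSum]
  push_cast
  exact Finset.sum_congr rfl fun j _ => by rw [hk]

theorem root_telescope (w : Fin (d + 1) → Fin (d + 1)) (b : Fin (d + 1)) :
    root (w 0) (w b) =
      ∑ l : Fin d, if l.castSucc < b then root (w l.castSucc) (w l.succ) else 0 := by
  induction b using Fin.induction with
  | zero => simp [root_self]
  | succ b ih =>
    rw [← root_add_root _ (w b.castSucc), ih, ← Finset.sum_filter, ← Finset.sum_filter]
    have : (Finset.univ.filter fun l : Fin d => l.castSucc < b.succ) =
        insert b (Finset.univ.filter fun l : Fin d => l.castSucc < b.castSucc) := by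
      ext l
      simp only [Finset.mem_filter, Finset.mem_univ, true_and, Finset.mem_insert, Fin.lt_def,
        Fin.ext_iff, Fin.val_castSucc, Fin.val_succ]
      omega
    rw [this, Finset.sum_insert (by simp)]
    exact add_comm _ _

/-- Summation by parts: tail sums are the coordinates in the basis of simple roots for the order
`w`. -/
theorem eq_sum_tailSum_smul_root (w : Equiv.Perm (Fin (d + 1))) {s : Fin (d + 1) → ℝ}
    (hs : ∑ i, s i = 0) : s = ∑ l : Fin d, tailSum w l s • root (w l.castSucc) (w l.succ) := by
  have h1 : s = ∑ b, s (w b) • root (w 0) (w b) := by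
    simp only [root, smul_sub, Finset.sum_sub_distrib, ← Finset.sum_smul]
    rw [Equiv.sum_comp w s, hs, zero_smul, sub_zero,
      Equiv.sum_comp w fun b => s b • (Pi.single b (1 : ℝ) : Fin (d + 1) → ℝ)]
    ext i
    simp [Finset.sum_apply, Pi.single_apply]
  conv_lhs => rw [h1]
  simp only [root_telescope, Finset.smul_sum, tailSum, Finset.sum_smul]
  rw [Finset.sum_comm]
  refine Finset.sum_congr rfl fun l _ => Finset.sum_congr rfl fun b _ => ?_
  split_ifs <;> simp

/-- Where `u` jumps strictly between positions `l` and `l + 1`, the indicator of the tail is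
increasing along `u`, so it lies in the cone and pairs nonnegatively with `s`. -/
theorem tailSum_nonneg {u : Fin (d + 1) → ℝ} {w : Equiv.Perm (Fin (d + 1))}
    (hw : Monotone (u ∘ w)) {l : Fin d} (hl : u (w l.castSucc) < u (w l.succ))
    {s : Fin (d + 1) → ℝ} (hs : s ∈ dualMonoid (rootLattice (d + 1)) (orderCone u)) :
    0 ≤ tailSum w l s := by
  have := hs.2 (functionalOf fun a => if l.castSucc < w.symm a then 1 else 0)
    (functionalOf_mem_orderCone.2 fun a b hab => by
      by_cases hb : l.castSucc < w.symm b
      · rw [if_pos hb]; split_ifs <;> simp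
      · rw [if_neg hb, if_neg]
        intro ha
        have h1 := hw (Fin.castSucc_lt_iff_succ_le.1 ha)
        have h2 := hw (not_lt.1 hb)
        simp only [Function.comp_apply, Equiv.apply_symm_apply] at h1 h2
        linarith)
  rw [functionalOf_apply, ← Equiv.sum_comp w] at this
  simpa [tailSum] using this

theorem dualMonoid_orderCone_eq (u : Fin (d + 1) → ℝ) :
    dualMonoid (rootLattice (d + 1)) (orderCone u) =
      AddSubmonoid.closure {s | ∃ a b, u a ≤ u b ∧ s = root a b} := by
  refine le_antisymm (fun s hs => ?_) ((AddSubmonoid.closure_le (S := dualMonoid (rootLattice (d + 1)) (orderCone u))).2 ?_)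
  · have hmem : ∀ a b, u a ≤ u b →
        root a b ∈ AddSubmonoid.closure {s | ∃ a b, u a ≤ u b ∧ s = root a b} :=
      fun a b h => AddSubmonoid.subset_closure ⟨a, b, h, rfl⟩
    have hw := Tuple.monotone_sort u
    rw [eq_sum_tailSum_smul_root (Tuple.sort u) hs.1.2]
    refine sum_mem fun l _ => ?_
    obtain ⟨k, hk⟩ := tailSum_int (Tuple.sort u) l hs.1
    rw [hk]
    have hle : u (Tuple.sort u l.castSucc) ≤ u (Tuple.sort u l.succ) :=
      hw (Fin.castSucc_lt_succ).le
    rcases le_or_gt 0 k with hk0 | hk0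
    · lift k to ℕ using hk0
      rw [Int.cast_natCast, Nat.cast_smul_eq_nsmul]
      exact nsmul_mem (hmem _ _ hle) k
    -- A negative coefficient occurs only at a tie of `u`, where the opposite root is in the monoid
    -- too.
    · have heq : u (Tuple.sort u l.succ) ≤ u (Tuple.sort u l.castSucc) := by
        by_contra! hlt
        have := tailSum_nonneg hw hlt hs
        rw [hk] at this
        exact absurd hk0 (not_lt.2 (by exact_mod_cast this))
      obtain ⟨j, rfl⟩ : ∃ j : ℕ, k = -j := ⟨k.natAbs, by omega⟩
      have : (((-j : ℤ) : ℤ) : ℝ) • root (Tuple.sort u l.castSucc) (Tuple.sort u l.succ) =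
          j • root (Tuple.sort u l.succ) (Tuple.sort u l.castSucc) := by
        rw [← Nat.cast_smul_eq_nsmul ℝ]
        simp only [root, Int.cast_neg, Int.cast_natCast, neg_smul, smul_sub]
        abel
      rw [this]
      exact nsmul_mem (hmem _ _ heq) j
  · rintro _ ⟨a, b, h, rfl⟩
    exact root_mem_dualMonoid.2 h

theorem dualMonoid_induction {u : Fin (d + 1) → ℝ}
    {P : dualMonoid (rootLattice (d + 1)) (orderCone u) → Prop}
    (hroot : ∀ a b (h : root a b ∈ dualMonoid (rootLattice (d + 1)) (orderCone u)), P ⟨_, h⟩)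
    (hzero : P 0) (hadd : ∀ s t, P s → P t → P (s + t))
    (s : dualMonoid (rootLattice (d + 1)) (orderCone u)) : P s := by
  obtain ⟨s, hs⟩ := s
  have hcl : s ∈ AddSubmonoid.closure {s | ∃ a b, u a ≤ u b ∧ s = root a b} := by
    rw [← dualMonoid_orderCone_eq]; exact hs
  suffices h : ∀ h', P ⟨s, h'⟩ from h hs
  induction hcl using AddSubmonoid.closure_induction with
  | mem x hx =>
    obtain ⟨a, b, h, rfl⟩ := hx
    exact fun h' => hroot a b h'
  | zero => exact fun _ => hzero
  | add x y hx hy ihx ihy =>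
    rw [← dualMonoid_orderCone_eq] at hx hy
    exact fun _ => hadd ⟨x, hx⟩ ⟨y, hy⟩ (ihx hx hx) (ihy hy hy)

/-- The value of a point of an affine toric variety at a root. -/
def AffineToric.atRoot {m : ℕ} {σ : Set ((Fin m → ℝ) →L[ℝ] ℝ)}
    (x : AffineToric (rootLattice m) σ) {a b : Fin m} (h : root a b ∈ dualMonoid (rootLattice m) σ) :
    ℂ := x (Multiplicative.ofAdd ⟨root a b, h⟩)

theorem affineToric_ext {u : Fin (d + 1) → ℝ}
    {x y : AffineToric (rootLattice (d + 1)) (orderCone u)}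
    (h : ∀ a b (hab : root a b ∈ dualMonoid (rootLattice (d + 1)) (orderCone u)),
      x.atRoot hab = y.atRoot hab) : x = y := by
  refine MonoidHom.ext fun s => ?_
  exact dualMonoid_induction (P := fun s => x (Multiplicative.ofAdd s) = y (Multiplicative.ofAdd s))
    h ((map_one x).trans (map_one y).symm)
    (fun s t hs ht => by rw [ofAdd_add, map_mul, map_mul, hs, ht]) s.toAdd

theorem AffineToric.atRoot_self {m : ℕ} {σ : Set ((Fin m → ℝ) →L[ℝ] ℝ)}
    (x : AffineToric (rootLattice m) σ) {a : Fin m}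
    (h : root a a ∈ dualMonoid (rootLattice m) σ) : x.atRoot h = 1 := by
  rw [← map_one x, atRoot]
  congr 2
  exact Subtype.ext (root_self a)

theorem AffineToric.atRoot_mul {m : ℕ} {σ : Set ((Fin m → ℝ) →L[ℝ] ℝ)}
    (x : AffineToric (rootLattice m) σ) {a b c : Fin m}
    (hab : root a b ∈ dualMonoid (rootLattice m) σ) (hbc : root b c ∈ dualMonoid (rootLattice m) σ)
    (hac : root a c ∈ dualMonoid (rootLattice m) σ) :
    x.atRoot hab * x.atRoot hbc = x.atRoot hac := by
  rw [atRoot, atRoot, atRoot, ← map_mul, ← ofAdd_add]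
  congr 2
  exact Subtype.ext (root_add_root a b c)

/-- The product of the entries of `z` between positions `a` and `b`. -/
def prodBetween {R : Type*} [CommMonoid R] (z : Fin d → R) (a b : Fin (d + 1)) : R :=
  ∏ l : Fin d, if a ≤ l.castSucc ∧ l.castSucc < b then z l else 1

theorem prodBetween_self {R : Type*} [CommMonoid R] (z : Fin d → R) (a : Fin (d + 1)) :
    prodBetween z a a = 1 :=
  Finset.prod_eq_one fun _ _ => if_neg fun h => absurd h.1 h.2.not_ge

theorem prodBetween_mul {R : Type*} [CommMonoid R] (z : Fin d → R) {a b c : Fin (d + 1)}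
    (hab : a ≤ b) (hbc : b ≤ c) :
    prodBetween z a b * prodBetween z b c = prodBetween z a c := by
  rw [prodBetween, prodBetween, prodBetween, ← Finset.prod_mul_distrib]
  refine Finset.prod_congr rfl fun l _ => ?_
  by_cases h1 : a ≤ l.castSucc <;> by_cases h2 : l.castSucc < b <;>
    by_cases h3 : b ≤ l.castSucc <;> by_cases h4 : l.castSucc < c <;> simp [h1, h2, h3, h4] <;> order

theorem prodBetween_consecutive {R : Type*} [CommMonoid R] (z : Fin d → R) (l : Fin d) :
    prodBetween z l.castSucc l.succ = z l := by
  rw [prodBetween, Finset.prod_eq_single l]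
  · simp
  · intro k _ hk
    refine if_neg fun h => hk ?_
    simp only [Fin.le_def, Fin.lt_def, Fin.val_castSucc, Fin.val_succ] at h
    ext
    omega
  · simp

/-- A cocycle along a chain is determined by its values at consecutive positions. -/
theorem eq_prodBetween {R : Type*} [CommMonoid R] (f : Fin (d + 1) → Fin (d + 1) → R)
    (h1 : ∀ a, f a a = 1) (hmul : ∀ a b c, a ≤ b → b ≤ c → f a b * f b c = f a c)
    {a b : Fin (d + 1)} (hab : a ≤ b) : f a b = prodBetween (fun l => f l.castSucc l.succ) a b := by
  induction b using Fin.induction with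
  | zero => rw [Fin.le_zero_iff.1 hab, h1, prodBetween_self]
  | succ b ih =>
    rcases hab.eq_or_lt with rfl | hlt
    · rw [h1, prodBetween_self]
    · have hle : a ≤ b.castSucc := Fin.le_castSucc_iff.2 hlt
      rw [← hmul a b.castSucc b.succ hle Fin.castSucc_lt_succ.le, ih hle,
        ← prodBetween_mul _ hle Fin.castSucc_lt_succ.le, prodBetween_consecutive]

/-- Sort the indices along `u` and send `s` to the product of the consecutive ratios raised to the
coordinates of `s` in the simple roots. These are integers on the root lattice, so taking floors
loses nothing. -/
theorem exists_affineToric_of_point {p : Pairs (d + 3) → CP1} (hp : p ∈ Fbar (d + 3))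
    {u : Fin (d + 1) → ℝ} (hu : ∀ a b, u a ≤ u b → coef p b a ≠ 0) :
    ∃ x : AffineToric (rootLattice (d + 1)) (orderCone u),
      ∀ a b (h : root a b ∈ dualMonoid (rootLattice (d + 1)) (orderCone u)),
        x.atRoot h = ratio p a b := by
  obtain ⟨w, hw⟩ : ∃ w : Equiv.Perm (Fin (d + 1)), Monotone (u ∘ w) :=
    ⟨Tuple.sort u, Tuple.monotone_sort u⟩
  have hfl : ∀ (l : Fin d) (s : dualMonoid (rootLattice (d + 1)) (orderCone u)),
      (⌊tailSum w l s⌋ : ℝ) = tailSum w l s := by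
    intro l s
    obtain ⟨k, hk⟩ := tailSum_int w l s.2.1
    rw [hk, Int.floor_intCast]
  have hadd : ∀ (l : Fin d) (s t : dualMonoid (rootLattice (d + 1)) (orderCone u)),
      ⌊tailSum w l (s + t : Fin (d + 1) → ℝ)⌋ = ⌊tailSum w l s⌋ + ⌊tailSum w l t⌋ := by
    intro l s t
    have := hfl l (s + t)
    rw [AddSubmonoid.coe_add] at this
    have h2 := tailSum_add w l s t
    rw [← this, ← hfl l s, ← hfl l t] at h2
    exact_mod_cast h2
  let x : AffineToric (rootLattice (d + 1)) (orderCone u) :=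
    { toFun := fun s => ∏ l : Fin d,
        ratio p (w l.castSucc) (w l.succ) ^ ⌊tailSum w l (s.toAdd : Fin (d + 1) → ℝ)⌋
      map_one' := by
        refine Finset.prod_eq_one fun l _ => ?_
        rw [toAdd_one, AddSubmonoid.coe_zero, tailSum_zero, Int.floor_zero, zpow_zero]
      map_mul' := by
        intro s t
        rw [← Finset.prod_mul_distrib]
        refine Finset.prod_congr rfl fun l _ => ?_
        rw [toAdd_mul, AddSubmonoid.coe_add, hadd]
        -- For a zero ratio the exponent law could fail, but then `u` jumps strictly and both
        -- exponents are nonnegative: either their sum is nonzero or both vanish.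
        refine zpow_add' ?_
        by_cases hz : ratio p (w l.castSucc) (w l.succ) = 0
        · right
          have hlt : u (w l.castSucc) < u (w l.succ) := by
            by_contra! h
            have h1 := hu _ _ h
            have h2 := hu _ _ (hw (Fin.castSucc_lt_succ (i := l)).le)
            exact div_ne_zero h1 h2 hz
          have hs := Int.floor_nonneg.2 (tailSum_nonneg hw hlt s.toAdd.2)
          have ht := Int.floor_nonneg.2 (tailSum_nonneg hw hlt t.toAdd.2)
          omega
        · exact Or.inl hz }
  refine ⟨x, ?_⟩
  have key : ∀ a b (hab : a ≤ b)
      (h : root (w a) (w b) ∈ dualMonoid (rootLattice (d + 1)) (orderCone u)),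
      x.atRoot h = ratio p (w a) (w b) := by
    intro a b hab h
    rw [eq_prodBetween (fun a b => ratio p (w a) (w b)) (fun a => ratio_self p _)
      (fun a b c h1 h2 => ratio_mul_ratio hp (hu _ _ (hw h1)) (hu _ _ (hw h2))
        (hu _ _ (hw (h1.trans h2)))) hab]
    change (∏ l : Fin d, ratio p (w l.castSucc) (w l.succ) ^
      ⌊tailSum w l (root (w a) (w b))⌋) = _
    refine Finset.prod_congr rfl fun l _ => ?_
    rw [tailSum_root]
    by_cases h1 : a ≤ l.castSucc <;> by_cases h2 : l.castSucc < b
    · simp [h1, h2, h1.not_gt]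
    · simp [h1, h2, h1.not_gt]
    · simp [h1, h2, not_le.1 h1]
    · exact absurd (lt_of_lt_of_le (not_le.1 h1) hab) h2
  intro a b h
  obtain ⟨a, rfl⟩ := w.surjective a
  obtain ⟨b, rfl⟩ := w.surjective b
  rcases le_total a b with hab | hab
  · exact key a b hab h
  -- Against the order of `w`, the root lies in the monoid only at a tie, and its value is the
  -- inverse of that of the opposite root.
  · have h' : root (w b) (w a) ∈ dualMonoid (rootLattice (d + 1)) (orderCone u) :=
      root_mem_dualMonoid.2 (hw hab)
    have h1 := key b a hab h'
    have h2 := x.atRoot_mul h h' (root_mem_dualMonoid.2 le_rfl)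
    rw [h1, x.atRoot_self] at h2
    rw [← ratio_inv]
    exact eq_inv_of_mul_eq_one_left h2

end DualMonoid

/-! ### The equivariant bijection with the permutohedral variety. -/

section Equivalence

variable {d : ℕ}

open Classical in
/-- The point of `(CP1)^N` with the homogeneous coordinates given by the values of `x` at the
roots. -/
noncomputable def toPoint {σ : Set ((Fin (d + 1) → ℝ) →L[ℝ] ℝ)}
    (x : AffineToric (rootLattice (d + 1)) σ) : Pairs (d + 3) → CP1 := fun P =>
  if h : root (Pairs.fst P) (Pairs.snd P) ∈ dualMonoid (rootLattice (d + 1)) σ then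
    Projectivization.mk ℂ ![x.atRoot h, 1] fun h0 => one_ne_zero (congrFun h0 1)
  else if h : root (Pairs.snd P) (Pairs.fst P) ∈ dualMonoid (rootLattice (d + 1)) σ then
    Projectivization.mk ℂ ![1, x.atRoot h] fun h0 => one_ne_zero (congrFun h0 0)
  -- Never reached for an order cone: the preorder is total, so one of the two roots is in the
  -- monoid.
  else Projectivization.mk ℂ ![1, 1] fun h0 => one_ne_zero (congrFun h0 0)

theorem toPoint_spec {σ : Set ((Fin (d + 1) → ℝ) →L[ℝ] ℝ)}
    (x : AffineToric (rootLattice (d + 1)) σ) {a b : Fin (d + 1)}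
    (h : root a b ∈ dualMonoid (rootLattice (d + 1)) σ) :
    coef (toPoint x) b a ≠ 0 ∧ ratio (toPoint x) a b = x.atRoot h := by
  rcases lt_trichotomy a b with hab | rfl | hab
  · have hP : toPoint x (pairOf a b hab) = Projectivization.mk ℂ ![x.atRoot h, 1]
        fun h0 => one_ne_zero (congrFun h0 1) := by
      have h' : root (Pairs.fst (pairOf a b hab)) (Pairs.snd (pairOf a b hab)) ∈
          dualMonoid (rootLattice (d + 1)) σ := by simpa using h
      rw [toPoint, dif_pos h']
      simp only [fst_pairOf, snd_pairOf]
    obtain ⟨z, hz, hz'⟩ := CP1.rep_mk ![x.atRoot h, 1] fun h0 => one_ne_zero (congrFun h0 1)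
    rw [ratio, coef_of_gt hab, coef_of_lt hab, hP, hz', hz']
    simp [hz]
  · simp [x.atRoot_self]
  · by_cases h2 : root b a ∈ dualMonoid (rootLattice (d + 1)) σ
    · have hP : toPoint x (pairOf b a hab) = Projectivization.mk ℂ ![x.atRoot h2, 1]
          fun h0 => one_ne_zero (congrFun h0 1) := by
        have h' : root (Pairs.fst (pairOf b a hab)) (Pairs.snd (pairOf b a hab)) ∈
            dualMonoid (rootLattice (d + 1)) σ := by simpa using h2
        rw [toPoint, dif_pos h']
        simp only [fst_pairOf, snd_pairOf]
      obtain ⟨z, hz, hz'⟩ := CP1.rep_mk ![x.atRoot h2, 1] fun h0 => one_ne_zero (congrFun h0 1)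
      -- With both roots in the monoid, `toPoint` uses the other one; the two values are mutually
      -- inverse.
      have hinv := x.atRoot_mul h h2 (by rw [root_self]; exact zero_mem _)
      rw [x.atRoot_self] at hinv
      have hne := right_ne_zero_of_mul_eq_one hinv
      rw [ratio, coef_of_gt hab, coef_of_lt hab, hP, hz', hz']
      refine ⟨mul_ne_zero hz hne, ?_⟩
      rw [eq_inv_of_mul_eq_one_left hinv, mul_div_mul_left _ _ hz]
      simp
    · have hP : toPoint x (pairOf b a hab) = Projectivization.mk ℂ ![1, x.atRoot h]
          fun h0 => one_ne_zero (congrFun h0 0) := by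
        have h' : root (Pairs.snd (pairOf b a hab)) (Pairs.fst (pairOf b a hab)) ∈
            dualMonoid (rootLattice (d + 1)) σ := by simpa using h
        rw [toPoint, dif_neg (by simpa using h2), dif_pos h']
        simp only [fst_pairOf, snd_pairOf]
      obtain ⟨z, hz, hz'⟩ := CP1.rep_mk ![1, x.atRoot h] fun h0 => one_ne_zero (congrFun h0 0)
      rw [ratio, coef_of_gt hab, coef_of_lt hab, hP, hz', hz']
      simp [hz]

theorem toPoint_eq_of_atRoot {u : Fin (d + 1) → ℝ}
    {x : AffineToric (rootLattice (d + 1)) (orderCone u)} {q : Pairs (d + 3) → CP1}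
    (H : ∀ a b (h : root a b ∈ dualMonoid (rootLattice (d + 1)) (orderCone u)),
      coef q b a ≠ 0 ∧ ratio q a b = x.atRoot h) : toPoint x = q := by
  refine point_ext_ratio fun a b => ?_
  rcases le_total (u a) (u b) with h | h
  · have h := root_mem_dualMonoid.2 h
    exact Or.inl ⟨(toPoint_spec x h).1, (H a b h).1, (toPoint_spec x h).2.trans (H a b h).2.symm⟩
  · have h := root_mem_dualMonoid.2 h
    exact Or.inr ⟨(toPoint_spec x h).1, (H b a h).1, (toPoint_spec x h).2.trans (H b a h).2.symm⟩

theorem toPoint_mem_Fbar {u : Fin (d + 1) → ℝ}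
    (x : AffineToric (rootLattice (d + 1)) (orderCone u)) : toPoint x ∈ Fbar (d + 3) := by
  refine mem_Fbar_of_ratio (u := u)
    (fun a b h => (toPoint_spec x (root_mem_dualMonoid.2 h)).1) fun a b c hab hbc => ?_
  rw [(toPoint_spec x (root_mem_dualMonoid.2 hab)).2, (toPoint_spec x (root_mem_dualMonoid.2 hbc)).2,
    (toPoint_spec x (root_mem_dualMonoid.2 (hab.trans hbc))).2, x.atRoot_mul]

theorem toPoint_toLarger {τ : Set ((Fin (d + 1) → ℝ) →L[ℝ] ℝ)} {u : Fin (d + 1) → ℝ}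
    (h : τ ⊆ orderCone u) (x : AffineToric (rootLattice (d + 1)) τ) :
    toPoint (AffineToric.toLarger _ h x) = toPoint x :=
  toPoint_eq_of_atRoot fun _ _ hab => toPoint_spec x (dualMonoid_anti _ h hab)

/-- The point of `F̄ₙ` given by a point of the permutohedral toric variety. -/
noncomputable def fromToric : PermutohedralVariety (d + 1) → Fbar (d + 3) :=
  Quot.lift (fun a => ⟨toPoint a.2, by
    obtain ⟨⟨σ, hσ⟩, x⟩ := a
    obtain ⟨u, rfl⟩ := mem_normalFan_iff.1 hσ
    exact toPoint_mem_Fbar x⟩) (by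
      rintro ⟨⟨τ, hτ⟩, x⟩ ⟨⟨σ, hσ⟩, y⟩ ⟨h, hy⟩
      obtain ⟨u, rfl⟩ := mem_normalFan_iff.1 hσ
      dsimp only at h hy
      subst hy
      exact Subtype.ext (toPoint_toLarger h x).symm)

theorem orderCone_mem_normalFan {m : ℕ} (u : Fin m → ℝ) :
    orderCone u ∈ normalFan (permutohedron m) := mem_normalFan_iff.2 ⟨u, rfl⟩

/-- The point of the toric variety given by a point of the affine chart of `orderCone u`. -/
def ofOrderCone {u : Fin (d + 1) → ℝ} (x : AffineToric (rootLattice (d + 1)) (orderCone u)) :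
    PermutohedralVariety (d + 1) :=
  Quot.mk _ ⟨⟨orderCone u, orderCone_mem_normalFan u⟩, x⟩

/-- The homomorphism with the coordinates of a point of `F̄ₙ`. -/
noncomputable def pointHom {p : Pairs (d + 3) → CP1} (hp : p ∈ Fbar (d + 3))
    {u : Fin (d + 1) → ℝ} (hu : ∀ a b, u a ≤ u b → coef p b a ≠ 0) :
    AffineToric (rootLattice (d + 1)) (orderCone u) :=
  (exists_affineToric_of_point hp hu).choose

theorem pointHom_atRoot {p : Pairs (d + 3) → CP1} (hp : p ∈ Fbar (d + 3))
    {u : Fin (d + 1) → ℝ} (hu : ∀ a b, u a ≤ u b → coef p b a ≠ 0) {a b : Fin (d + 1)}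
    (h : root a b ∈ dualMonoid (rootLattice (d + 1)) (orderCone u)) :
    (pointHom hp hu).atRoot h = ratio p a b :=
  (exists_affineToric_of_point hp hu).choose_spec a b h

/-- The point of the permutohedral toric variety given by a point of `F̄ₙ`. -/
noncomputable def toToric (p : Fbar (d + 3)) : PermutohedralVariety (d + 1) :=
  ofOrderCone (pointHom p.2 fun _ _ => (pointRank_le_iff p.2).1)

/-- The cone of the preorder of `p` is contained in every order cone on which the ratios of `p` are
finite, so gluing along this inclusion identifies the two chart points. -/
theorem ofOrderCone_eq_toToric (p : Fbar (d + 3)) {u : Fin (d + 1) → ℝ}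
    (hu : ∀ a b, u a ≤ u b → coef p.1 b a ≠ 0)
    {x : AffineToric (rootLattice (d + 1)) (orderCone u)}
    (hx : ∀ a b (h : root a b ∈ dualMonoid (rootLattice (d + 1)) (orderCone u)),
      x.atRoot h = ratio p.1 a b) : ofOrderCone x = toToric p := by
  have hsub : orderCone (pointRank p.1) ⊆ orderCone u := fun v hv a b hab =>
    hv a b ((pointRank_le_iff p.2).2 (hu a b hab))
  refine (Quot.sound ⟨hsub, affineToric_ext fun a b h => ?_⟩).symm
  rw [hx]
  exact (pointHom_atRoot p.2 (fun _ _ => (pointRank_le_iff p.2).1)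
    (dualMonoid_anti _ hsub h)).symm

/-- The bijection between `F̄ₙ` and the permutohedral toric variety. -/
noncomputable def equivToric : Fbar (d + 3) ≃ PermutohedralVariety (d + 1) where
  toFun := toToric
  invFun := fromToric
  left_inv p := Subtype.ext <| toPoint_eq_of_atRoot fun a b h =>
    ⟨(pointRank_le_iff p.2).1 (root_mem_dualMonoid.1 h),
      (pointHom_atRoot p.2 (fun _ _ => (pointRank_le_iff p.2).1) h).symm⟩
  right_inv y := by
    obtain ⟨⟨⟨σ, hσ⟩, x⟩, rfl⟩ := Quot.exists_rep y
    obtain ⟨u, rfl⟩ := mem_normalFan_iff.1 hσ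
    exact (ofOrderCone_eq_toToric ⟨toPoint x, toPoint_mem_Fbar x⟩
      (fun a b h => (toPoint_spec x (root_mem_dualMonoid.2 h)).1)
      (fun a b h => (toPoint_spec x h).2.symm)).symm

/-- The isomorphism of the root lattice with `ℤ^d` that forgets the first coordinate. -/
noncomputable def rootLatticeEquiv : rootLattice (d + 1) ≃+ (Fin d → ℤ) where
  toFun v l := ⌊v.1 l.succ⌋
  invFun k := ⟨Fin.cons (-∑ l, (k l : ℝ)) fun l => (k l : ℝ), fun i => by
      refine Fin.cases ⟨-∑ l, k l, by simp⟩ (fun l => ⟨k l, by simp⟩) i,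
    by simp [Fin.sum_univ_succ]⟩
  left_inv v := by
    have hfl : ∀ i, (⌊v.1 i⌋ : ℝ) = v.1 i := fun i => by
      obtain ⟨k, hk⟩ := v.2.1 i
      rw [hk, Int.floor_intCast]
    have hs := v.2.2
    rw [Fin.sum_univ_succ] at hs
    ext i
    refine Fin.cases ?_ (fun l => ?_) i
    · simp only [hfl, Fin.cons_zero]
      linarith
    · simp only [hfl, Fin.cons_succ]
  right_inv k := by
    ext l
    simp
  map_add' v w := by
    ext l
    obtain ⟨k, hk⟩ := v.2.1 l.succ
    obtain ⟨j, hj⟩ := w.2.1 l.succ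
    simp only [AddSubgroup.coe_add, Pi.add_apply, hk, hj, ← Int.cast_add, Int.floor_intCast]

theorem prod_zpow_extendOne (t : Fin d → ℂˣ) (b : Fin (d + 1)) :
    ∏ l : Fin d, t l ^ (if l.succ = b then (1 : ℤ) else 0) = extendOne t b := by
  refine Fin.cases ?_ (fun k => ?_) b
  · simp [extendOne, Fin.succ_ne_zero]
  · rw [Finset.prod_eq_single k] <;> simp +contextual [extendOne]

/-- Forgetting the first lattice coordinate amounts to setting `t_0 = 1`, which is what `extendOne`
does. -/
theorem torusOfLatticeIso_root (t : Fin d → ℂˣ) (a b : Fin (d + 1)) :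
    torusOfLatticeIso rootLatticeEquiv t
      (Multiplicative.ofAdd ⟨root a b, root_mem_rootLattice a b⟩) =
      extendOne t b / extendOne t a := by
  rw [← prod_zpow_extendOne t a, ← prod_zpow_extendOne t b, ← Finset.prod_div_distrib]
  change (∏ l : Fin d, t l ^ rootLatticeEquiv ⟨root a b, root_mem_rootLattice a b⟩ l) = _
  refine Finset.prod_congr rfl fun l _ => ?_
  rw [div_eq_mul_inv, ← zpow_sub]
  congr 1
  change ⌊root a b l.succ⌋ = _
  rw [Int.floor_eq_iff]
  simp only [root, Pi.sub_apply, Pi.single_apply]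
  push_cast
  simp

theorem fromToric_act (t : Fin d → ℂˣ) (y : PermutohedralVariety (d + 1)) :
    (fromToric (ToricVariety.act (torusOfLatticeIso rootLatticeEquiv t) y) : Pairs (d + 3) → CP1) =
      torusAct (n := d + 3) t (fromToric y : Pairs (d + 3) → CP1) := by
  obtain ⟨⟨⟨σ, hσ⟩, x⟩, rfl⟩ := Quot.exists_rep y
  obtain ⟨u, rfl⟩ := mem_normalFan_iff.1 hσ
  refine toPoint_eq_of_atRoot (x := AffineToric.act _ _ x) fun a b h => ?_
  have hx := toPoint_spec x h
  refine ⟨(coef_torusAct_ne_zero t).2 hx.1, ?_⟩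
  rw [ratio_torusAct]
  change _ * ratio (toPoint x) a b = _
  rw [hx.2]
  change _ = ((torusOfLatticeIso rootLatticeEquiv t
    (Multiplicative.ofAdd ⟨root a b, root_mem_rootLattice a b⟩) : ℂˣ) : ℂ) * x.atRoot h
  rw [torusOfLatticeIso_root, Units.val_div_eq_div_val]

theorem equivToric_torusAct (t : Fin d → ℂˣ) (p : Fbar (d + 3)) :
    equivToric ⟨torusAct (n := d + 3) t p, torusAct_mem_Fbar t p.2⟩ =
      ToricVariety.act (torusOfLatticeIso rootLatticeEquiv t) (equivToric p) := by
  rw [← Equiv.eq_symm_apply]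
  refine Subtype.ext ?_
  refine Eq.trans ?_ (fromToric_act t (equivToric p)).symm
  exact congrArg (fun q : Fbar (d + 3) => torusAct (n := d + 3) t q)
    (equivToric.symm_apply_apply p).symm

end Equivalence

/-! ### Morphisms between varieties given by charts. -/

namespace ChartData

variable {X Y : Type}

/-- `F` is, near the point `x` of the chart `a`, a quotient of elements of the coordinate ring. -/
def RegularNear (𝒜 : ChartData X) (a : 𝒜.Chart) (x : 𝒜.pts a) (F : 𝒜.pts a → ℂ) : Prop :=
  ∃ f ∈ 𝒜.coord a, ∃ g ∈ 𝒜.coord a, g x ≠ 0 ∧ ∀ y, g y ≠ 0 → F y = f y / g y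

section RegularNear

variable {𝒜 : ChartData X} {a : 𝒜.Chart} {x : 𝒜.pts a} {F G : 𝒜.pts a → ℂ}

theorem RegularNear.of_mem (h : F ∈ 𝒜.coord a) : 𝒜.RegularNear a x F :=
  ⟨F, h, 1, one_mem _, one_ne_zero, fun y _ => by simp⟩

theorem RegularNear.inv_of_mem (h : F ∈ 𝒜.coord a) (hx : F x ≠ 0) :
    𝒜.RegularNear a x fun y => (F y)⁻¹ :=
  ⟨1, one_mem _, F, h, hx, fun y _ => by simp⟩

theorem RegularNear.add (hF : 𝒜.RegularNear a x F) (hG : 𝒜.RegularNear a x G) :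
    𝒜.RegularNear a x (F + G) := by
  obtain ⟨f, hf, g, hg, hgx, h⟩ := hF
  obtain ⟨f', hf', g', hg', hgx', h'⟩ := hG
  refine ⟨f * g' + g * f', add_mem (mul_mem hf hg') (mul_mem hg hf'), g * g', mul_mem hg hg',
    mul_ne_zero hgx hgx', fun y hy => ?_⟩
  have h1 := left_ne_zero_of_mul hy
  have h2 := right_ne_zero_of_mul hy
  rw [Pi.add_apply, h y h1, h' y h2, div_add_div _ _ h1 h2]
  rfl

theorem RegularNear.mul (hF : 𝒜.RegularNear a x F) (hG : 𝒜.RegularNear a x G) :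
    𝒜.RegularNear a x (F * G) := by
  obtain ⟨f, hf, g, hg, hgx, h⟩ := hF
  obtain ⟨f', hf', g', hg', hgx', h'⟩ := hG
  refine ⟨f * f', mul_mem hf hf', g * g', mul_mem hg hg', mul_ne_zero hgx hgx', fun y hy => ?_⟩
  rw [Pi.mul_apply, h y (left_ne_zero_of_mul hy), h' y (right_ne_zero_of_mul hy), div_mul_div_comm]
  rfl

theorem RegularNear.congr (hF : 𝒜.RegularNear a x F) {k : 𝒜.pts a → ℂ} (hk : k ∈ 𝒜.coord a)
    (hkx : k x ≠ 0) (h : ∀ y, k y ≠ 0 → G y = F y) : 𝒜.RegularNear a x G := by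
  obtain ⟨f, hf, g, hg, hgx, h'⟩ := hF
  refine ⟨k * f, mul_mem hk hf, k * g, mul_mem hk hg, mul_ne_zero hkx hgx, fun y hy => ?_⟩
  have h1 : k y ≠ 0 := left_ne_zero_of_mul hy
  rw [h y h1, h' y (right_ne_zero_of_mul hy), Pi.mul_apply, Pi.mul_apply, mul_div_mul_left _ _ h1]

/-- Local quotients are closed under sums and products and contain constants, so generators suffice.
-/
theorem RegularNear.comp_adjoin {T : Type} {S : Set (T → ℂ)} {φ : 𝒜.pts a → T}
    (hS : ∀ s ∈ S, 𝒜.RegularNear a x (s ∘ φ)) {h : T → ℂ} (hh : h ∈ Algebra.adjoin ℂ S) :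
    𝒜.RegularNear a x (h ∘ φ) := by
  induction hh using Algebra.adjoin_induction with
  | mem s hs => exact hS s hs
  | algebraMap r => exact .of_mem (Subalgebra.algebraMap_mem _ r)
  | add f g _ _ hf hg => exact hf.add hg
  | mul f g _ _ hf hg => exact hf.mul hg

end RegularNear

/-- `f` is locally given by regular functions between charts. -/
def IsMorphism (𝒜 : ChartData X) (ℬ : ChartData Y) (f : X → Y) : Prop :=
  ∀ (a : 𝒜.Chart) (x : 𝒜.pts a), ∃ (b : ℬ.Chart) (φ : 𝒜.pts a → ℬ.pts b),
    (∃ g ∈ 𝒜.coord a, g x ≠ 0 ∧ ∀ y, g y ≠ 0 → f (𝒜.incl a y) = ℬ.incl b (φ y)) ∧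
    ∀ h ∈ ℬ.coord b, 𝒜.RegularNear a x (h ∘ φ)

variable {𝒜 : ChartData X} {ℬ : ChartData Y}

theorem IsMorphism.continuous {f : X → Y} (hf : IsMorphism 𝒜 ℬ f) :
    @Continuous X Y 𝒜.topology ℬ.topology f := by
  let _ := 𝒜.topology
  let _ := ℬ.topology
  refine continuous_def.2 fun W hW a x hx => ?_
  obtain ⟨b, φ, ⟨g, hg, hgx, hgf⟩, hreg⟩ := hf a x
  rw [Set.mem_preimage, hgf x hgx] at hx
  obtain ⟨h, hh, hhx, hhW⟩ := hW b _ hx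
  obtain ⟨k, hk, l, hl, hlx, hkl⟩ := hreg h hh
  refine ⟨g * (k * l), mul_mem hg (mul_mem hk hl), mul_ne_zero hgx (mul_ne_zero ?_ hlx),
    fun y hy => ?_⟩
  · intro h0
    have := hkl x hlx
    rw [h0, zero_div] at this
    exact hhx this
  · have h1 : g y ≠ 0 := left_ne_zero_of_mul hy
    have h2 : k y * l y ≠ 0 := right_ne_zero_of_mul hy
    rw [Set.mem_preimage, hgf y h1]
    refine hhW _ ?_
    have := hkl y (right_ne_zero_of_mul h2)
    rw [Function.comp_apply] at this
    rw [this]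
    exact div_ne_zero (left_ne_zero_of_mul h2) (right_ne_zero_of_mul h2)

theorem IsMorphism.isRegularOn {f : X → Y} (hf : IsMorphism 𝒜 ℬ f) {W : Set Y} {ψ : Y → ℂ}
    (hψ : ℬ.IsRegularOn W ψ) : 𝒜.IsRegularOn (f ⁻¹' W) (ψ ∘ f) := by
  intro a x hx
  obtain ⟨b, φ, ⟨g, hg, hgx, hgf⟩, hreg⟩ := hf a x
  rw [Set.mem_preimage, hgf x hgx] at hx
  obtain ⟨h₁, hh₁, h₂, hh₂, hx₂, hψ'⟩ := hψ b _ hx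
  obtain ⟨k₁, hk₁, l₁, hl₁, hlx₁, hkl₁⟩ := hreg h₁ hh₁
  obtain ⟨k₂, hk₂, l₂, hl₂, hlx₂, hkl₂⟩ := hreg h₂ hh₂
  -- This is `(k₁ / l₁) / (k₂ / l₂)`, expanded by `g * l₂` so that a nonzero denominator implies all
  -- the needed local conditions.
  refine ⟨(g * l₂) * (k₁ * l₂), mul_mem (mul_mem hg hl₂) (mul_mem hk₁ hl₂),
    (g * l₂) * (l₁ * k₂), mul_mem (mul_mem hg hl₂) (mul_mem hl₁ hk₂),
    mul_ne_zero (mul_ne_zero hgx hlx₂) (mul_ne_zero hlx₁ ?_), fun y hyW hy => ?_⟩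
  · intro h0
    have := hkl₂ x hlx₂
    rw [h0, zero_div] at this
    exact hx₂ this
  · have e1 : g y * l₂ y ≠ 0 := left_ne_zero_of_mul hy
    have e2 : l₁ y * k₂ y ≠ 0 := right_ne_zero_of_mul hy
    have n1 := left_ne_zero_of_mul e1
    have n2 := right_ne_zero_of_mul e1
    have n3 := left_ne_zero_of_mul e2
    have n4 := right_ne_zero_of_mul e2
    have r1 := hkl₁ y n3
    have r2 := hkl₂ y n2
    rw [Function.comp_apply] at r1 r2
    rw [Set.mem_preimage, hgf y n1] at hyW
    rw [Function.comp_apply, hgf y n1, hψ' _ hyW (by rw [r2]; exact div_ne_zero n4 n2), r1, r2]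
    simp only [Pi.mul_apply]
    field_simp

theorem IsIso.of_isMorphism {e : X ≃ Y} (h : IsMorphism 𝒜 ℬ e) (h' : IsMorphism ℬ 𝒜 e.symm) :
    IsIso 𝒜 ℬ e where
  homeo := by
    let _ := 𝒜.topology
    let _ := ℬ.topology
    exact (Homeomorph.mk e h.continuous h'.continuous).isHomeomorph
  regular W _ φ := by
    refine ⟨fun hφ => h.isRegularOn hφ, fun hφ => ?_⟩
    have := h'.isRegularOn hφ
    rwa [Function.comp_assoc, e.self_comp_symm, Function.comp_id, ← Set.preimage_comp,
      e.self_comp_symm, Set.preimage_id] at this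

end ChartData

/-! ### The bijection is regular in both directions. -/

section Isomorphism

open ChartData

variable {d : ℕ} {p : Pairs (d + 3) → CP1}

theorem rep_zero_eq_coef (p : Pairs (d + 3) → CP1) (P : Pairs (d + 3)) :
    (p P).rep 0 = coef p (Pairs.fst P) (Pairs.snd P) := by
  rw [coef_of_lt P.fst_lt_snd, pairOf_fst_snd]

theorem rep_one_eq_coef (p : Pairs (d + 3) → CP1) (P : Pairs (d + 3)) :
    (p P).rep 1 = coef p (Pairs.snd P) (Pairs.fst P) := by
  rw [coef_of_gt P.fst_lt_snd, pairOf_fst_snd]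

theorem affCoord_one (p : Pairs (d + 3) → CP1) (P : Pairs (d + 3)) :
    affCoord 1 (p P) = ratio p (Pairs.fst P) (Pairs.snd P) := by
  rw [affCoord, ratio, sub_self, rep_zero_eq_coef, rep_one_eq_coef]

theorem affCoord_zero (p : Pairs (d + 3) → CP1) (P : Pairs (d + 3)) :
    affCoord 0 (p P) = ratio p (Pairs.snd P) (Pairs.fst P) := by
  rw [affCoord, ratio, sub_zero, rep_zero_eq_coef, rep_one_eq_coef]

theorem affCoords_mem_coord {ι : Type} (Z : Set (ι → CP1)) (ε : ι → Fin 2) (i : ι) :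
    (fun q : {q : Z // (q : ι → CP1) ∈ affChart ε} => affCoords ε q.1.1 i) ∈
      (subvarietyCharts Z).coord ε :=
  Algebra.subset_adjoin (A := {q : Z // (q : ι → CP1) ∈ affChart ε} → ℂ) (Set.mem_range_self i)

theorem affCoord_ne_zero_iff {e : Fin 2} {q : CP1} (h : q.rep e ≠ 0) :
    affCoord e q ≠ 0 ↔ q.rep (1 - e) ≠ 0 := by
  simp [affCoord, h]

/-- Off the diagonal, the chart coordinate of the pair is either this ratio or its inverse. In the
latter case it is nonzero at `x`, because `coef x.1.1 b a ≠ 0`. -/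
theorem regularNear_ratio (Z : Set (Pairs (d + 3) → CP1)) (ε : Pairs (d + 3) → Fin 2)
    (x : (subvarietyCharts Z).pts ε) {a b : Fin (d + 1)} (h : coef x.1.1 b a ≠ 0) :
    (subvarietyCharts Z).RegularNear ε x fun q => ratio q.1.1 a b := by
  rcases lt_trichotomy a b with hab | rfl | hab
  · have hmem := affCoords_mem_coord Z ε (pairOf a b hab)
    rcases Fin.exists_fin_two.1 ⟨ε (pairOf a b hab), rfl⟩ with he | he
    · simp only [affCoords, he, affCoord_zero, fst_pairOf, snd_pairOf] at hmem
      have := RegularNear.inv_of_mem (x := x) hmem (by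
        have := x.2 (pairOf a b hab)
        rw [he, rep_zero_eq_coef, fst_pairOf, snd_pairOf] at this
        exact div_ne_zero h this)
      simpa only [ratio_inv] using this
    · simp only [affCoords, he, affCoord_one, fst_pairOf, snd_pairOf] at hmem
      exact .of_mem hmem
  · simp only [ratio_self]
    exact .of_mem (one_mem _)
  · have hmem := affCoords_mem_coord Z ε (pairOf b a hab)
    rcases Fin.exists_fin_two.1 ⟨ε (pairOf b a hab), rfl⟩ with he | he
    · simp only [affCoords, he, affCoord_zero, fst_pairOf, snd_pairOf] at hmem
      exact .of_mem hmem
    · simp only [affCoords, he, affCoord_one, fst_pairOf, snd_pairOf] at hmem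
      have := RegularNear.inv_of_mem (x := x) hmem (by
        have := x.2 (pairOf b a hab)
        rw [he, rep_one_eq_coef, fst_pairOf, snd_pairOf] at this
        exact div_ne_zero h this)
      simpa only [ratio_inv] using this

instance (n : ℕ) : Finite (Pairs n) := by
  refine Set.Finite.subset (Set.finite_Iic (n, n)) fun p hp => ?_
  exact ⟨by have := hp.2; dsimp; omega, hp.2.2⟩

/-- The product of the affine coordinates that are nonzero at `x` cuts out a neighborhood where no
further homogeneous coordinate vanishes. Thus ratios finite at `x` stay finite nearby; this also
makes the big orbit open. -/
theorem exists_coord_ne_zero (Z : Set (Pairs (d + 3) → CP1)) (ε : Pairs (d + 3) → Fin 2)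
    (x : (subvarietyCharts Z).pts ε) :
    ∃ g ∈ (subvarietyCharts Z).coord ε, g x ≠ 0 ∧
      ∀ y : (subvarietyCharts Z).pts ε, g y ≠ 0 →
        ∀ a b, coef x.1.1 a b ≠ 0 → coef y.1.1 a b ≠ 0 := by
  classical
  have := Fintype.ofFinite (Pairs (d + 3))
  let g : Pairs (d + 3) → (subvarietyCharts Z).pts ε → ℂ := fun i q =>
    if affCoords ε x.1.1 i = 0 then 1 else affCoords ε q.1.1 i
  have hgx : ∀ i, g i x ≠ 0 := by
    intro i
    by_cases h : affCoords ε x.1.1 i = 0 <;> simp [g, h]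
  refine ⟨∏ i, g i, prod_mem fun i _ => ?_, ?_, fun y hy => ?_⟩
  · by_cases h : affCoords ε x.1.1 i = 0
    · simp only [g, h, if_true]
      exact one_mem _
    · simp only [g, h, if_false]
      exact affCoords_mem_coord Z ε i
  · rw [Finset.prod_apply]
    exact Finset.prod_ne_zero_iff.2 fun i _ => hgx i
  · rw [Finset.prod_apply] at hy
    have hrep : ∀ i k, (x.1.1 i).rep k ≠ 0 → (y.1.1 i).rep k ≠ 0 := by
      intro i k hk
      by_cases he : ε i = k
      · exact he ▸ y.2 i
      · have key : ∀ e k : Fin 2, e ≠ k → k = 1 - e := by decide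
        have hk' := key _ _ he
        subst hk'
        rw [← affCoord_ne_zero_iff (x.2 i)] at hk
        rw [← affCoord_ne_zero_iff (y.2 i)]
        have := Finset.prod_ne_zero_iff.1 hy i (Finset.mem_univ _)
        simp only [g] at this
        rwa [if_neg (show ¬affCoords ε x.1.1 i = 0 from hk)] at this
    intro a b
    rcases lt_trichotomy a b with h | rfl | h
    · rw [coef_of_lt h, coef_of_lt h]; exact hrep _ _
    · simp
    · rw [coef_of_gt h, coef_of_gt h]; exact hrep _ _

theorem isMorphism_equivToric :
    IsMorphism (subvarietyCharts (Fbar (d + 3))) (permutohedralCharts (d + 1)) equivToric := by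
  classical
  intro ε x
  let u := pointRank x.1.1
  obtain ⟨g, hg, hgx, hgy⟩ := exists_coord_ne_zero _ ε x
  have hu : ∀ a b, u a ≤ u b → coef x.1.1 b a ≠ 0 := fun a b => (pointRank_le_iff x.1.2).1
  -- The target chart is that of the preorder of `x`; the second branch is a default value, not met
  -- where `g` is nonzero.
  let φ : (subvarietyCharts (Fbar (d + 3))).pts ε →
      AffineToric (rootLattice (d + 1)) (orderCone u) := fun q =>
    if h : ∀ a b, u a ≤ u b → coef q.1.1 b a ≠ 0 then pointHom q.1.2 h else pointHom x.1.2 hu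
  have hφ : ∀ q, g q ≠ 0 → ∀ a b
      (h : root a b ∈ dualMonoid (rootLattice (d + 1)) (orderCone u)),
      (φ q).atRoot h = ratio q.1.1 a b := by
    intro q hq a b h
    have hc : ∀ a b, u a ≤ u b → coef q.1.1 b a ≠ 0 := fun a b hab => hgy q hq _ _ (hu a b hab)
    simp only [φ, dif_pos hc]
    exact pointHom_atRoot _ _ h
  refine ⟨⟨orderCone u, orderCone_mem_normalFan u⟩, φ, ⟨g, hg, hgx, fun q hq => ?_⟩,
    fun f hf => ?_⟩
  · exact (ofOrderCone_eq_toToric q.1 (fun a b hab => hgy q hq _ _ (hu a b hab)) (hφ q hq)).symm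
  · refine RegularNear.comp_adjoin ?_ hf
    rintro _ ⟨s, rfl⟩
    refine dualMonoid_induction (P := fun s : dualMonoid (rootLattice (d + 1)) (orderCone u) =>
      (subvarietyCharts (Fbar (d + 3))).RegularNear ε x fun q => φ q (Multiplicative.ofAdd s))
      (fun a b h => ?_) ?_ (fun s t hs ht => ?_) s
    · exact (regularNear_ratio _ ε x (hu a b (root_mem_dualMonoid.1 h))).congr hg hgx
        fun q hq => hφ q hq a b h
    · simp only [ofAdd_zero, map_one]
      exact .of_mem (one_mem _)
    · simp only [ofAdd_add, map_mul]
      exact hs.mul ht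

theorem isMorphism_equivToric_symm :
    IsMorphism (permutohedralCharts (d + 1)) (subvarietyCharts (Fbar (d + 3)))
      equivToric.symm := by
  classical
  rintro ⟨σ, hσ⟩ x
  obtain ⟨u, rfl⟩ := mem_normalFan_iff.1 hσ
  -- This selects the coordinate known not to vanish, so all of `U_σ` maps into one affine chart,
  -- with affine coordinates the values at roots.
  let ε : Pairs (d + 3) → Fin 2 := fun P => if u (Pairs.fst P) ≤ u (Pairs.snd P) then 1 else 0
  let φ : AffineToric (rootLattice (d + 1)) (orderCone u) →
      (subvarietyCharts (Fbar (d + 3))).pts ε := fun y => ⟨⟨toPoint y, toPoint_mem_Fbar y⟩, by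
    intro P
    by_cases h : u (Pairs.fst P) ≤ u (Pairs.snd P)
    · simp only [ε, h, if_true, rep_one_eq_coef]
      exact (toPoint_spec y (root_mem_dualMonoid.2 h)).1
    · simp only [ε, h, if_false, rep_zero_eq_coef]
      exact (toPoint_spec y (root_mem_dualMonoid.2 (le_of_not_ge h))).1⟩
  refine ⟨ε, φ, ⟨1, one_mem _, one_ne_zero, fun _ _ => rfl⟩, fun f hf => ?_⟩
  refine RegularNear.comp_adjoin ?_ hf
  rintro _ ⟨P, rfl⟩
  have hmem : ∀ {a b} (h : root a b ∈ dualMonoid (rootLattice (d + 1)) (orderCone u)),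
      (fun y : AffineToric (rootLattice (d + 1)) (orderCone u) => y.atRoot h) ∈
        (permutohedralCharts (d + 1)).coord ⟨orderCone u, hσ⟩ := fun h =>
    Algebra.subset_adjoin (A := AffineToric (rootLattice (d + 1)) (orderCone u) → ℂ)
      (Set.mem_range_self (⟨_, h⟩ : dualMonoid (rootLattice (d + 1)) (orderCone u)))
  by_cases h : u (Pairs.fst P) ≤ u (Pairs.snd P)
  · have h' := root_mem_dualMonoid.2 h
    refine RegularNear.congr (.of_mem (hmem h')) (one_mem _) one_ne_zero fun y _ => ?_
    simp only [affCoords, ε, h, if_true, affCoord_one, φ]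
    exact (toPoint_spec y h').2
  · have h' := root_mem_dualMonoid.2 (le_of_not_ge h)
    refine RegularNear.congr (.of_mem (hmem h')) (one_mem _) one_ne_zero fun y _ => ?_
    simp only [affCoords, ε, h, if_false, affCoord_zero, φ]
    exact (toPoint_spec y h').2

theorem isIso_equivToric :
    IsIso (subvarietyCharts (Fbar (d + 3))) (permutohedralCharts (d + 1)) equivToric :=
  .of_isMorphism isMorphism_equivToric isMorphism_equivToric_symm

end Isomorphism

/-! ### Each standard chart is an affine space. -/

section AffineCoordinates

variable {ι : Type}

theorem affCoords_injOn (ε : ι → Fin 2) : Set.InjOn (affCoords ε) (affChart ε) := by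
  intro p hp q hq h
  funext i
  have h1 := hp i
  have h2 := hq i
  have h3 := congrFun h i
  simp only [affCoords, affCoord] at h3
  rw [div_eq_div_iff h1 h2] at h3
  revert h3
  generalize ε i = e
  intro h3
  refine CP1.ext_cross ?_
  fin_cases e
  · simp only [Fin.zero_eta, sub_zero] at h3
    linear_combination -h3
  · simp only [Fin.mk_one, sub_self] at h3
    linear_combination h3

theorem exists_affCoords_eq (ε : ι → Fin 2) (c : ι → ℂ) :
    ∃ p ∈ affChart ε, affCoords ε p = c := by
  have h : ∀ i, ∃ q : CP1, q.rep (ε i) ≠ 0 ∧ affCoord (ε i) q = c i := by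
    intro i
    generalize ε i = e
    fin_cases e
    · obtain ⟨z, hz, hz'⟩ := CP1.rep_mk ![1, c i] fun h0 => one_ne_zero (congrFun h0 0)
      exact ⟨_, by rw [hz']; simpa using hz, by simp [affCoord, hz', hz]⟩
    · obtain ⟨z, hz, hz'⟩ := CP1.rep_mk ![c i, 1] fun h0 => one_ne_zero (congrFun h0 1)
      exact ⟨_, by rw [hz']; simpa using hz, by simp [affCoord, hz', hz]⟩
  choose p hp hp' using h
  exact ⟨p, hp, funext hp'⟩

end AffineCoordinates

/-! ### Charts of linear orders and smoothness. -/

section PermutationCharts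

variable {d : ℕ} (w : Equiv.Perm (Fin (d + 1)))

/-- The position, in the order given by `w`, of the index of a pair that comes first. -/
def loPos (P : Pairs (d + 3)) : Fin (d + 1) :=
  min (w.symm (Pairs.fst P)) (w.symm (Pairs.snd P))

/-- The position, in the order given by `w`, of the index of a pair that comes last. -/
def hiPos (P : Pairs (d + 3)) : Fin (d + 1) :=
  max (w.symm (Pairs.fst P)) (w.symm (Pairs.snd P))

/-- The affine chart adapted to the order given by `w`. -/
def permChart (P : Pairs (d + 3)) : Fin 2 :=
  if w.symm (Pairs.fst P) < w.symm (Pairs.snd P) then 1 else 0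

theorem symm_fst_ne_snd (P : Pairs (d + 3)) :
    w.symm (Pairs.fst P) ≠ w.symm (Pairs.snd P) :=
  fun h => P.fst_lt_snd.ne (w.symm.injective h)

theorem loPos_lt_hiPos (P : Pairs (d + 3)) : loPos w P < hiPos w P :=
  min_lt_max.2 (symm_fst_ne_snd w P)

theorem exists_pair {i j : Fin (d + 1)} (h : i < j) : ∃ P, loPos w P = i ∧ hiPos w P = j := by
  rcases lt_or_gt_of_ne (w.injective.ne h.ne) with hw | hw
  · exact ⟨pairOf _ _ hw, by simp [loPos, h.le], by simp [hiPos, h.le]⟩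
  · exact ⟨pairOf _ _ hw, by simp [loPos, h.le], by simp [hiPos, h.le]⟩

theorem affCoords_permChart (p : Pairs (d + 3) → CP1) (P : Pairs (d + 3)) :
    affCoords (permChart w) p P = ratio p (w (loPos w P)) (w (hiPos w P)) := by
  rw [affCoords, permChart]
  rcases lt_or_gt_of_ne (symm_fst_ne_snd w P) with h | h
  · rw [if_pos h, affCoord_one]
    simp [loPos, hiPos, h.le]
  · rw [if_neg h.not_gt, affCoord_zero]
    simp [loPos, hiPos, h.le]

theorem rep_permChart (p : Pairs (d + 3) → CP1) (P : Pairs (d + 3)) :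
    (p P).rep (permChart w P) = coef p (w (hiPos w P)) (w (loPos w P)) := by
  rw [permChart]
  rcases lt_or_gt_of_ne (symm_fst_ne_snd w P) with h | h
  · rw [if_pos h, rep_one_eq_coef]
    simp [loPos, hiPos, h.le]
  · rw [if_neg h.not_gt, rep_zero_eq_coef]
    simp [loPos, hiPos, h.le]

variable {w} {p : Pairs (d + 3) → CP1}

theorem mem_permChart_iff :
    p ∈ affChart (permChart w) ↔ ∀ i j, i ≤ j → coef p (w j) (w i) ≠ 0 := by
  constructor
  · intro hp i j hij
    rcases hij.eq_or_lt with rfl | hlt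
    · simp
    · obtain ⟨P, rfl, rfl⟩ := exists_pair w hlt
      rw [← rep_permChart]
      exact hp P
  · intro h P
    rw [rep_permChart]
    exact h _ _ (loPos_lt_hiPos w P).le

/-- Refining the preorder of a point to a linear order shows that these charts cover `F̄ₙ`. -/
theorem mem_permChart_sort (hp : p ∈ Fbar (d + 3)) :
    p ∈ affChart (permChart (Tuple.sort (pointRank p))) :=
  mem_permChart_iff.2 fun _ _ hij => (pointRank_le_iff hp).1 (Tuple.monotone_sort (pointRank p) hij)

theorem ratio_eq_prodBetween (hp : p ∈ Fbar (d + 3)) (hpw : p ∈ affChart (permChart w))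
    {i j : Fin (d + 1)} (hij : i ≤ j) : ratio p (w i) (w j) =
      prodBetween (fun l : Fin d => ratio p (w l.castSucc) (w l.succ)) i j :=
  eq_prodBetween (fun i j => ratio p (w i) (w j)) (fun _ => ratio_self p _)
    (fun _ _ _ h1 h2 => ratio_mul_ratio hp (mem_permChart_iff.1 hpw _ _ h1)
      (mem_permChart_iff.1 hpw _ _ h2) (mem_permChart_iff.1 hpw _ _ (h1.trans h2))) hij

theorem mem_Fbar_of_prodBetween (hpw : p ∈ affChart (permChart w)) {z : Fin d → ℂ}
    (h : ∀ P, affCoords (permChart w) p P = prodBetween z (loPos w P) (hiPos w P)) :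
    p ∈ Fbar (d + 3) := by
  have hz : ∀ i j, i ≤ j → ratio p (w i) (w j) = prodBetween z i j := by
    intro i j hij
    rcases hij.eq_or_lt with rfl | hlt
    · rw [ratio_self, prodBetween_self]
    · obtain ⟨P, rfl, rfl⟩ := exists_pair w hlt
      rw [← h, affCoords_permChart]
  refine mem_Fbar_of_ratio (u := fun a => ((w.symm a : ℕ) : ℝ)) (fun a b hab => ?_)
    fun a b c hab hbc => ?_
  · obtain ⟨i, rfl⟩ := w.surjective a
    obtain ⟨j, rfl⟩ := w.surjective b
    exact mem_permChart_iff.1 hpw i j (by simpa using hab)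
  · obtain ⟨i, rfl⟩ := w.surjective a
    obtain ⟨j, rfl⟩ := w.surjective b
    obtain ⟨k, rfl⟩ := w.surjective c
    have h1 : i ≤ j := by simpa using hab
    have h2 : j ≤ k := by simpa using hbc
    rw [hz _ _ h1, hz _ _ h2, hz _ _ (h1.trans h2), prodBetween_mul z h1 h2]

theorem mem_Fbar_iff_affCoords (hpw : p ∈ affChart (permChart w)) {s : Fin d → Pairs (d + 3)}
    (hs : ∀ l, loPos w (s l) = l.castSucc ∧ hiPos w (s l) = l.succ) :
    p ∈ Fbar (d + 3) ↔ ∀ P, affCoords (permChart w) p P =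
      prodBetween (fun l => affCoords (permChart w) p (s l)) (loPos w P) (hiPos w P) := by
  refine ⟨fun hp P => ?_, fun h => mem_Fbar_of_prodBetween hpw h⟩
  rw [affCoords_permChart, ratio_eq_prodBetween hp hpw (loPos_lt_hiPos w P).le]
  congr 1
  funext l
  rw [affCoords_permChart, (hs l).1, (hs l).2]

theorem map_prodBetween {R S F : Type*} [CommMonoid R] [CommMonoid S] [FunLike F R S]
    [MonoidHomClass F R S] (f : F) (z : Fin d → R) (a b : Fin (d + 1)) :
    f (prodBetween z a b) = prodBetween (fun l => f (z l)) a b := by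
  rw [prodBetween, map_prod, prodBetween]
  exact Finset.prod_congr rfl fun l _ => by split_ifs <;> simp

theorem pderiv_prodBetween {ι : Type} {i : ι} {z : Fin d → MvPolynomial ι ℂ}
    (hz : ∀ l, MvPolynomial.pderiv i (z l) = 0) (a b : Fin (d + 1)) :
    MvPolynomial.pderiv i (prodBetween z a b) = 0 := by
  refine Finset.prod_induction _ (fun f => MvPolynomial.pderiv i f = 0) (fun f g hf hg => ?_)
    (Derivation.map_one_eq_zero _) fun l _ => ?_
  · rw [Derivation.leibniz, hf, hg, smul_zero, smul_zero, add_zero]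
  · split_ifs
    · exact hz l
    · exact Derivation.map_one_eq_zero _

theorem isSmoothOfDim_Fbar : IsSmoothOfDim d (Fbar (d + 3)) := by
  classical
  intro p hp
  obtain ⟨w, hpw⟩ : ∃ w, p ∈ affChart (permChart w) := ⟨_, mem_permChart_sort hp⟩
  choose s hs using fun l : Fin d => exists_pair w (Fin.castSucc_lt_succ (i := l))
  have hinj : Function.Injective s := fun l k h => by
    have := (hs l).1.symm.trans ((congrArg _ h).trans (hs k).1)
    exact Fin.castSucc_injective _ this
  let B := {P : Pairs (d + 3) // P ∉ Set.range s}
  let e : B ≃ Fin (Nat.card B) := Finite.equivFin B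
  let F : Pairs (d + 3) → MvPolynomial (Pairs (d + 3)) ℂ := fun P =>
    MvPolynomial.X P - prodBetween (fun l => MvPolynomial.X (s l)) (loPos w P) (hiPos w P)
  have hF : ∀ q P, MvPolynomial.eval (affCoords (permChart w) q) (F P) =
      affCoords (permChart w) q P -
        prodBetween (fun l => affCoords (permChart w) q (s l)) (loPos w P) (hiPos w P) := by
    intro q P
    simp only [F, map_sub, MvPolynomial.eval_X, map_prodBetween]
  refine ⟨permChart w, hpw, Nat.card B, fun k => F (e.symm k).1, 1, ?_, by simp,
    fun q hq _ => ?_, ?_⟩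
  · have h1 : Nat.card (Set.range s) = d := by
      rw [Nat.card_range_of_injective hinj, Nat.card_fin]
    have h2 := Nat.card_congr (Equiv.Set.sumCompl (Set.range s))
    rw [Nat.card_sum, h1] at h2
    rw [← h2, add_comm]
    rfl
  · rw [mem_Fbar_iff_affCoords hq hs]
    constructor
    · intro h k
      rw [hF, ← h, sub_self]
    · intro h P
      by_cases hP : P ∈ Set.range s
      · obtain ⟨l, rfl⟩ := hP
        rw [(hs l).1, (hs l).2, prodBetween_consecutive]
      · have := h (e ⟨P, hP⟩)
        rw [hF, e.symm_apply_apply] at this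
        exact sub_eq_zero.1 this
  -- The subtracted products involve only the consecutive variables, so the Jacobian restricted to
  -- the other columns is the identity up to relabeling.
  · refine LinearIndependent.of_comp (LinearMap.funLeft ℂ ℂ (Subtype.val : B → Pairs (d + 3))) ?_
    have hli := (Pi.basisFun ℂ B).linearIndependent.comp e.symm e.symm.injective
    convert hli using 1
    funext k Q
    have h0 : ∀ l, MvPolynomial.pderiv Q.1 (MvPolynomial.X (R := ℂ) (s l)) = 0 := fun l =>
      MvPolynomial.pderiv_X_of_ne fun h => Q.2 ⟨l, h⟩
    simp only [Function.comp_apply, LinearMap.funLeft_apply, F, map_sub, pderiv_prodBetween h0,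
      Pi.basisFun_apply, MvPolynomial.pderiv_X]
    by_cases hQ : (e.symm k) = Q
    · simp [hQ]
    · have hQ' : (e.symm k).1 ≠ Q.1 := fun h => hQ (Subtype.ext h)
      simp [hQ', Ne.symm hQ]

/-! ### Polynomial parametrization, irreducibility and the open orbit. -/

variable (w) in
theorem exists_permChart_point (z : Fin d → ℂ) :
    ∃ q : Fbar (d + 3), q.1 ∈ affChart (permChart w) ∧
      ∀ P, affCoords (permChart w) q.1 P = prodBetween z (loPos w P) (hiPos w P) := by
  obtain ⟨q, hq, hq'⟩ := exists_affCoords_eq (permChart w)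
    fun P => prodBetween z (loPos w P) (hiPos w P)
  exact ⟨⟨q, mem_Fbar_of_prodBetween hq (congrFun hq')⟩, hq, congrFun hq'⟩

variable (w) in
/-- The parametrization of a chart of `F̄ₙ` by `ℂ^d`. -/
noncomputable def chartPoint (z : Fin d → ℂ) :
    (subvarietyCharts (Fbar (d + 3))).pts (permChart w) :=
  ⟨(exists_permChart_point w z).choose, (exists_permChart_point w z).choose_spec.1⟩

theorem affCoords_chartPoint (z : Fin d → ℂ) (P : Pairs (d + 3)) :
    affCoords (permChart w) (chartPoint w z).1.1 P = prodBetween z (loPos w P) (hiPos w P) :=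
  (exists_permChart_point w z).choose_spec.2 P

theorem exists_chartPoint_eq (x : (subvarietyCharts (Fbar (d + 3))).pts (permChart w)) :
    ∃ z, chartPoint w z = x := by
  refine ⟨fun l => ratio x.1.1 (w l.castSucc) (w l.succ), Subtype.ext (Subtype.ext ?_)⟩
  refine affCoords_injOn (permChart w) (chartPoint w _).2 x.2 (funext fun P => ?_)
  rw [affCoords_chartPoint, affCoords_permChart,
    ratio_eq_prodBetween x.1.2 x.2 (loPos_lt_hiPos w P).le]

theorem exists_eval_eq_chartPoint
    {f : (subvarietyCharts (Fbar (d + 3))).pts (permChart w) → ℂ}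
    (hf : f ∈ (subvarietyCharts (Fbar (d + 3))).coord (permChart w)) :
    ∃ G : MvPolynomial (Fin d) ℂ, ∀ z, f (chartPoint w z) = MvPolynomial.eval z G := by
  refine Algebra.adjoin_induction
    (p := fun (f : (subvarietyCharts (Fbar (d + 3))).pts (permChart w) → ℂ) _ =>
      ∃ G : MvPolynomial (Fin d) ℂ, ∀ z, f (chartPoint w z) = MvPolynomial.eval z G)
    ?_ ?_ ?_ ?_ hf
  · rintro _ ⟨P, rfl⟩
    refine ⟨prodBetween MvPolynomial.X (loPos w P) (hiPos w P), fun z => ?_⟩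
    simp only [map_prodBetween, MvPolynomial.eval_X]
    exact affCoords_chartPoint z P
  · exact fun r => ⟨MvPolynomial.C r, fun z => by rw [MvPolynomial.eval_C]; rfl⟩
  · rintro f g _ _ ⟨F, hF⟩ ⟨G, hG⟩
    exact ⟨F + G, fun z => by rw [map_add, ← hF, ← hG]; rfl⟩
  · rintro f g _ _ ⟨F, hF⟩ ⟨G, hG⟩
    exact ⟨F * G, fun z => by rw [map_mul, ← hF, ← hG]; rfl⟩

/-- Coordinate functions pull back to polynomials on `ℂ^d`, so an open set meeting the chart
contains the complement of a hypersurface there. -/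
theorem exists_polynomial_of_isOpen {W : Set (Fbar (d + 3))}
    (hW : @IsOpen _ (subvarietyCharts (Fbar (d + 3))).topology W) {q : Fbar (d + 3)} (hq : q ∈ W)
    (hqw : q.1 ∈ affChart (permChart w)) :
    ∃ G : MvPolynomial (Fin d) ℂ, G ≠ 0 ∧
      ∀ z, MvPolynomial.eval z G ≠ 0 → (chartPoint w z).1 ∈ W := by
  obtain ⟨g, hg, hgx, hgW⟩ := hW (permChart w) ⟨q, hqw⟩ hq
  obtain ⟨G, hG⟩ := exists_eval_eq_chartPoint hg
  refine ⟨G, ?_, fun z hz => hgW (chartPoint w z) (by rwa [hG])⟩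
  rintro rfl
  obtain ⟨z, hz⟩ := exists_chartPoint_eq (w := w) ⟨q, hqw⟩
  exact hgx (by rw [← hz, hG, map_zero])

theorem exists_eval_ne_zero {G : MvPolynomial (Fin d) ℂ} (hG : G ≠ 0) :
    ∃ z, MvPolynomial.eval z G ≠ 0 := by
  by_contra! h
  exact hG (MvPolynomial.funext fun z => by rw [h, map_zero])

theorem exists_mem_coef_ne_zero {W : Set (Fbar (d + 3))}
    (hW : @IsOpen _ (subvarietyCharts (Fbar (d + 3))).topology W) (hne : W.Nonempty) :
    ∃ q ∈ W, ∀ a b, coef q.1 a b ≠ 0 := by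
  obtain ⟨q, hq⟩ := hne
  obtain ⟨w, hqw⟩ : ∃ w, q.1 ∈ affChart (permChart w) := ⟨_, mem_permChart_sort q.2⟩
  obtain ⟨G, hG, hGW⟩ := exists_polynomial_of_isOpen hW hq hqw
  -- The extra factor, the product of all variables, makes every coordinate of `z` nonzero.
  obtain ⟨z, hz⟩ := exists_eval_ne_zero (mul_ne_zero hG
    (Finset.prod_ne_zero_iff.2 fun l (_ : l ∈ Finset.univ) => MvPolynomial.X_ne_zero (R := ℂ) l))
  rw [map_mul, map_prod] at hz
  have hz0 : ∀ l, z l ≠ 0 := fun l => by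
    simpa using Finset.prod_ne_zero_iff.1 (right_ne_zero_of_mul hz) l (Finset.mem_univ l)
  refine ⟨_, hGW z (left_ne_zero_of_mul hz), fun a b => ?_⟩
  have hr : ∀ i j, i < j → ratio (chartPoint w z).1.1 (w i) (w j) ≠ 0 := by
    intro i j hij
    obtain ⟨P, rfl, rfl⟩ := exists_pair w hij
    rw [← affCoords_permChart, affCoords_chartPoint]
    exact Finset.prod_ne_zero_iff.2 fun l _ => by split_ifs <;> simp [hz0]
  obtain ⟨i, rfl⟩ := w.surjective a
  obtain ⟨j, rfl⟩ := w.surjective b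
  rcases lt_trichotomy i j with h | rfl | h
  · exact (div_ne_zero_iff.1 (hr i j h)).1
  · simp
  · exact (div_ne_zero_iff.1 (hr j i h)).2

/-- The point all of whose coordinates are `(1 : 1)`. -/
noncomputable def onePoint (P : Pairs (d + 3)) : CP1 :=
  (fun _ => Projectivization.mk ℂ ![1, 1] fun h0 => one_ne_zero (congrFun h0 0)) P

theorem coef_onePoint (a b : Fin (d + 1)) : coef (onePoint (d := d)) a b ≠ 0 := by
  obtain ⟨z, hz, hz'⟩ := CP1.rep_mk ![1, 1] fun h0 => one_ne_zero (congrFun h0 0)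
  rcases lt_trichotomy a b with h | rfl | h
  · rw [coef_of_lt h, onePoint, hz']; simpa using hz
  · simp
  · rw [coef_of_gt h, onePoint, hz']; simpa using hz

theorem ratio_onePoint (a b : Fin (d + 1)) : ratio (onePoint (d := d)) a b = 1 := by
  obtain ⟨z, hz, hz'⟩ := CP1.rep_mk ![1, 1] fun h0 => one_ne_zero (congrFun h0 0)
  rcases lt_trichotomy a b with h | rfl | h
  · rw [ratio, coef_of_lt h, coef_of_gt h, onePoint, hz', hz']; simp [hz]
  · simp
  · rw [ratio, coef_of_lt h, coef_of_gt h, onePoint, hz', hz']; simp [hz]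

theorem onePoint_mem_Fbar : onePoint ∈ Fbar (d + 3) :=
  mem_Fbar_of_ratio (u := 0) (fun _ _ _ => coef_onePoint _ _)
    fun _ _ _ _ _ => by simp only [ratio_onePoint, mul_one]

theorem irreducibleSpace_Fbar :
    @IrreducibleSpace (Fbar (d + 3)) (subvarietyCharts (Fbar (d + 3))).topology := by
  let _ := (subvarietyCharts (Fbar (d + 3))).topology
  refine @IrreducibleSpace.mk _ _ ⟨?_⟩ ⟨⟨onePoint, onePoint_mem_Fbar⟩⟩
  rintro W₁ W₂ hW₁ hW₂ ⟨q₁, -, h₁⟩ ⟨q₂, -, h₂⟩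
  -- A point with no vanishing coordinate lies in every chart, so `W₁` and `W₂` both meet the chart
  -- of `q₂`, where two nonzero polynomials are simultaneously nonzero somewhere.
  obtain ⟨q, hq, hq0⟩ := exists_mem_coef_ne_zero hW₁ ⟨q₁, h₁⟩
  obtain ⟨w, hw⟩ : ∃ w, q₂.1 ∈ affChart (permChart w) := ⟨_, mem_permChart_sort q₂.2⟩
  obtain ⟨G₁, hG₁, hGW₁⟩ := exists_polynomial_of_isOpen hW₁ hq
    (mem_permChart_iff (w := w) |>.2 fun _ _ _ => hq0 _ _)
  obtain ⟨G₂, hG₂, hGW₂⟩ := exists_polynomial_of_isOpen hW₂ h₂ hw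
  obtain ⟨z, hz⟩ := exists_eval_ne_zero (mul_ne_zero hG₁ hG₂)
  rw [map_mul] at hz
  exact ⟨_, trivial, hGW₁ z (left_ne_zero_of_mul hz), hGW₂ z (right_ne_zero_of_mul hz)⟩

theorem eq_one_of_torusAct_onePoint {t : Fin d → ℂˣ}
    (h : torusAct (n := d + 3) t onePoint = onePoint) : t = 1 := by
  funext l
  have := ratio_torusAct (p := onePoint) (a := 0) (b := l.succ) t
  rw [h, ratio_onePoint] at this
  simpa [extendOne, eq_comm] using this

theorem exists_torusAct_onePoint (hp : p ∈ Fbar (d + 3)) (h : ∀ a b, coef p a b ≠ 0) :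
    ∃ t : Fin d → ℂˣ, p = torusAct (n := d + 3) t onePoint := by
  -- Since `t_0 = 1`, the parameter at index `a` must be the ratio from `0` to `a`; the cocycle rule
  -- gives the other ratios.
  refine ⟨fun l => Units.mk0 (ratio p 0 l.succ) (div_ne_zero (h _ _) (h _ _)), ?_⟩
  have hext : ∀ a, (extendOne (fun l : Fin d => Units.mk0 (ratio p 0 l.succ)
      (div_ne_zero (h _ _) (h _ _))) a : ℂ) = ratio p 0 a := by
    intro a
    refine Fin.cases ?_ (fun l => ?_) a
    · simp [extendOne]
    · rfl
  refine point_ext_ratio fun a b =>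
    Or.inl ⟨h _ _, (coef_torusAct_ne_zero _).2 (coef_onePoint _ _), ?_⟩
  rw [ratio_torusAct, ratio_onePoint, hext, hext, mul_one, div_eq_mul_inv, ratio_inv, mul_comm,
    ratio_mul_ratio hp (h _ _) (h _ _) (h _ _)]

theorem isOpen_orbit_onePoint : @IsOpen (Fbar (d + 3)) (subvarietyCharts (Fbar (d + 3))).topology
    {q | ∃ t : Fin d → ℂˣ, (q : Pairs (d + 3) → CP1) = torusAct (n := d + 3) t onePoint} := by
  intro ε x hx
  obtain ⟨g, hg, hgx, hgy⟩ := exists_coord_ne_zero _ ε x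
  refine ⟨g, hg, hgx, fun y hy => exists_torusAct_onePoint y.1.2 fun a b => hgy y hy a b ?_⟩
  obtain ⟨t, ht⟩ := hx
  change x.1.1 = _ at ht
  rw [ht]
  exact (coef_torusAct_ne_zero t).2 (coef_onePoint _ _)

end PermutationCharts

end PermutohedralToric

/-- `F̄ₙ ⊆ (ℂP¹)^N` is invariant under the `(ℂ*)^(n-3)`-action, is a smooth toric variety for it
(irreducible, smooth of dimension `n - 3`, with an open orbit with trivial stabilizer), and is
isomorphic, as a variety with torus action, to the toric variety of the permutohedron on `n - 2`
letters. -/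
theorem mainTheorem5 (n : ℕ) (hn : 3 ≤ n) :
    ∃ hinv : ∀ (t : Fin (n - 3) → ℂˣ), ∀ c ∈ Fbar n, torusAct t c ∈ Fbar n,
      IsSmoothOfDim (n - 3) (Fbar n) ∧
      @IrreducibleSpace (Fbar n) (subvarietyCharts (Fbar n)).topology ∧
      (∃ c ∈ Fbar n,
        (∀ t : Fin (n - 3) → ℂˣ, torusAct t c = c → t = 1) ∧
        @IsOpen (Fbar n) (subvarietyCharts (Fbar n)).topology
          {q : Fbar n | ∃ t : Fin (n - 3) → ℂˣ, (q : Pairs n → CP1) = torusAct t c}) ∧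
      ∃ (A : rootLattice (n - 2) ≃+ (Fin (n - 3) → ℤ))
        (e : Fbar n ≃ PermutohedralVariety (n - 2)),
        ChartData.IsIso (subvarietyCharts (Fbar n)) (permutohedralCharts (n - 2)) e ∧
        ∀ (t : Fin (n - 3) → ℂˣ) (c : Fbar n),
          e ⟨torusAct t c, hinv t c c.2⟩ = ToricVariety.act (torusOfLatticeIso A t) (e c) := by
  obtain ⟨d, rfl⟩ := Nat.exists_eq_add_of_le' hn
  exact ⟨fun t _ hc => torusAct_mem_Fbar (d := d) t hc, isSmoothOfDim_Fbar (d := d),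
    irreducibleSpace_Fbar (d := d),
    ⟨onePoint, onePoint_mem_Fbar (d := d), fun _ ht => eq_one_of_torusAct_onePoint (d := d) ht,
      isOpen_orbit_onePoint (d := d)⟩,
    rootLatticeEquiv (d := d), equivToric (d := d), isIso_equivToric (d := d),
    fun t c => equivToric_torusAct (d := d) t c⟩
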